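/- Let $\beta>0$, let $\mathcal H,\mathcal Y$ be complex Hilbert spaces, and let $A$ be the generator of a strongly continuous semigroup $(T(t))_{t\ge 0}$ of contractions on $\mathcal H$. Let $C$ be a bounded linear operator from the domain $D(A)$, equipped with the graph norm, to $\mathcal Y$. For $\operatorname{Re}\lambda>0$ and $s>0$ let $(\lambda-A)^{-s}\in\mathcal L(\mathcal H)$ be the fractional power $$(\lambda-A)^{-s}x=\frac1{\Gamma(s)}\int_0^\infty t^{s-1}e^{-\lambda t}T(t)x\,dt ,$$ whose range lies in $D(A)$ if $s\ge 1$. Let $T:=(I+A)(I-A)^{-1}\in\mathcal L(\mathcal H)$ be the cogenerator (a contraction) and put $F:=C(I-A)^{-(1+\beta)}\in\mathcal L(\mathcal H,\mathcal Y)$. Then the following hold. 1. $C$ is a $\beta$-admissible observation operator for $(T(t))_{t\ge0}$, i.e. there is a constant $M>0$ with $$\int_0^\infty t^\beta\|C\,T(t)x\|^2\,dt\le M\|x\|^2\qquad\text{for all }x\in D(A),$$ if and only if $F$ is a $\beta$-admissible observation operator for $T$, i.e. there is a constant $M>0$ with $$\sum_{n=0}^\infty(1+n)^\beta\|F\,T^n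 x\|^2\le M\|x\|^2\qquad\text{for all }x\in\mathcal H.$$ 2. One has $$\sup_{|z|<1}\,(1-|z|^2)^{\frac{1+\beta}2}\,\bigl\|F(I-\bar zT)^{-\beta-1}\bigr\|_{\mathcal L(\mathcal H,\mathcal Y)}<\infty$$ if and only if $$\sup_{\operatorname{Re}\lambda>0}\,(\operatorname{Re}\lambda)^{\frac{1+\beta}2}\,\bigl\|C(\lambda-A)^{-(1+\beta)}\bigr\|_{\mathcal L(\mathcal H,\mathcal Y)}<\infty ,$$ where $(I-\bar zT)^{-\beta-1}$ is given by the (norm convergent) binomial series. -/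

import Mathlib

open Set Filter Topology MeasureTheory
open scoped NNReal ENNReal

noncomputable section

/-- A strongly continuous semigroup of contractions on a complex normed space. -/
structure ContractionSemigroup (X : Type*) [NormedAddCommGroup X] [NormedSpace ℂ X] where
  /-- The operator at time `t`. -/
  toFun : ℝ≥0 → X →L[ℂ] X
  map_zero' : toFun 0 = ContinuousLinearMap.id ℂ X
  map_add' : ∀ s t, toFun (s + t) = (toFun s).comp (toFun t)
  continuous' : ∀ x, Continuous fun t => toFun t x
  norm_le_one' : ∀ t, ‖toFun t‖ ≤ 1

namespace ContractionSemigroup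

section Generator

variable {X : Type*} [NormedAddCommGroup X] [NormedSpace ℂ X]

instance : CoeFun (ContractionSemigroup X) fun _ => ℝ≥0 → X →L[ℂ] X := ⟨toFun⟩

/-- `(S h x - x) / h → y` as `h → 0+`. -/
def HasGenerator (S : ContractionSemigroup X) (x y : X) : Prop :=
  Tendsto (fun h : ℝ => h⁻¹ • (S h.toNNReal x - x)) (𝓝[>] 0) (𝓝 y)

variable (S : ContractionSemigroup X)

theorem HasGenerator.unique {S : ContractionSemigroup X} {x y z : X}
    (h : S.HasGenerator x y) (h' : S.HasGenerator x z) : y = z :=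
  tendsto_nhds_unique h h'

theorem HasGenerator.add {S : ContractionSemigroup X} {x y x' y' : X}
    (h : S.HasGenerator x y) (h' : S.HasGenerator x' y') :
    S.HasGenerator (x + x') (y + y') := by
  refine (Tendsto.add h h').congr fun t => ?_
  rw [← smul_add, map_add]
  congr 1
  abel

theorem HasGenerator.map {S : ContractionSemigroup X} {x y : X} (h : S.HasGenerator x y)
    (L : X →L[ℂ] X) (hL : ∀ t z, L (S t z) = S t (L z)) : S.HasGenerator (L x) (L y) := by
  refine ((L.continuous.tendsto y).comp h).congr fun t => ?_
  simp only [Function.comp_apply]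
  rw [L.map_smul_of_tower, map_sub, hL]

theorem HasGenerator.smul {S : ContractionSemigroup X} {x y : X} (c : ℂ)
    (h : S.HasGenerator x y) : S.HasGenerator (c • x) (c • y) :=
  h.map (c • ContinuousLinearMap.id ℂ X) (by simp)

/-- The infinitesimal generator `A` of the semigroup: its domain consists of all `x` for which
`lim_{h → 0+} (S h x - x) / h` exists, and `A x` is that limit. -/
def generator : X →ₗ.[ℂ] X where
  domain :=
    { carrier := {x | ∃ y, S.HasGenerator x y}
      zero_mem' := ⟨0, by simp [HasGenerator]⟩
      add_mem' := fun ⟨_, h⟩ ⟨_, h'⟩ => ⟨_, h.add h'⟩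
      smul_mem' := fun c _ ⟨_, h⟩ => ⟨_, h.smul c⟩ }
  toFun :=
    { toFun := fun x => Classical.choose x.2
      map_add' := fun x y => (Classical.choose_spec (x + y).2).unique
        ((Classical.choose_spec x.2).add (Classical.choose_spec y.2))
      map_smul' := fun c x => (Classical.choose_spec (c • x).2).unique
        ((Classical.choose_spec x.2).smul c) }

theorem hasGenerator (x : S.generator.domain) : S.HasGenerator x (S.generator x) :=
  Classical.choose_spec x.2

/-- The domain `D(A)` of the generator, as a type of its own: it carries the graph norm. -/
def Domain : Type _ := S.generator.domain

instance : AddCommGroup S.Domain := inferInstanceAs (AddCommGroup S.generator.domain)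

instance : Module ℂ S.Domain := inferInstanceAs (Module ℂ S.generator.domain)

/-- The map `x ↦ (x, A x)` from `D(A)` to `X × X`. -/
def graphMap : S.Domain →ₗ[ℂ] X × X :=
  S.generator.domain.subtype.prod S.generator.toFun

theorem graphMap_injective : Function.Injective S.graphMap := fun _ _ h =>
  Subtype.ext (congrArg Prod.fst h)

/-- The graph norm `max ‖x‖ ‖A x‖` (equivalent to `‖x‖ + ‖A x‖`) on `D(A)`. -/
instance : NormedAddCommGroup S.Domain :=
  NormedAddCommGroup.induced S.Domain (X × X) S.graphMap S.graphMap_injective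

instance : NormedSpace ℂ S.Domain := NormedSpace.induced ℂ S.Domain (X × X) S.graphMap

theorem domain_norm_def (x : S.Domain) : ‖x‖ = max ‖(S.graphMap x).1‖ ‖(S.graphMap x).2‖ := rfl

/-- The inclusion of `D(A)` in `X`, a bounded operator for the graph norm. -/
def incl : S.Domain →L[ℂ] X :=
  LinearMap.mkContinuous S.generator.domain.subtype 1 fun x => by
    rw [one_mul, domain_norm_def]; exact le_max_left _ _

/-- The generator `A` as a bounded operator from `D(A)` with the graph norm to `X`. -/
def gen : S.Domain →L[ℂ] X :=
  LinearMap.mkContinuous S.generator.toFun 1 fun x => by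
    rw [one_mul, domain_norm_def]; exact le_max_right _ _

theorem hasGenerator' (x : S.Domain) : S.HasGenerator (S.incl x) (S.gen x) :=
  S.hasGenerator x

theorem comm (s t : ℝ≥0) (x : X) : S s (S t x) = S t (S s x) := by
  rw [← ContinuousLinearMap.comp_apply, ← S.map_add', add_comm, S.map_add',
    ContinuousLinearMap.comp_apply]

/-- The restriction of `S t` to a map from `D(A)` to `D(A)`. -/
def onDomain (t : ℝ≥0) (x : S.Domain) : S.Domain :=
  ⟨S t (S.incl x), S t (S.gen x), (S.hasGenerator' x).map (S t) fun _ _ => S.comm _ _ _⟩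

theorem norm_apply_le (t : ℝ≥0) (x : X) : ‖S t x‖ ≤ ‖x‖ := by
  simpa using (S t).le_of_opNorm_le (S.norm_le_one' t) x

end Generator

section Powers

variable {X : Type*} [NormedAddCommGroup X] [NormedSpace ℂ X]
variable (S : ContractionSemigroup X)

/-- The integrand `t ^ (s - 1) e ^ (-l t) S(t) x`. -/
def powIntegrand (l : ℂ) (s : ℝ) (x : X) (t : ℝ) : X :=
  (((t ^ (s - 1) : ℝ) : ℂ) * Complex.exp (-l * t)) • S t.toNNReal x

theorem continuous_orbit (x : X) : Continuous fun t : ℝ => S t.toNNReal x :=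
  (S.continuous' x).comp continuous_real_toNNReal

theorem norm_powIntegrand_le (l : ℂ) (s : ℝ) (x : X) {t : ℝ} (ht : 0 < t) :
    ‖S.powIntegrand l s x t‖ ≤ t ^ (s - 1) * Real.exp (-l.re * t) * ‖x‖ := by
  unfold powIntegrand
  rw [norm_smul, norm_mul, Complex.norm_real, Complex.norm_exp,
    Real.norm_of_nonneg (Real.rpow_nonneg ht.le _)]
  have : (-l * (t : ℂ)).re = -l.re * t := by simp
  rw [this]
  gcongr
  exact S.norm_apply_le _ _

theorem integrableOn_powMajorant {l : ℂ} (hl : 0 < l.re) {s : ℝ} (hs : 0 < s) (c : ℝ) :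
    IntegrableOn (fun t : ℝ => t ^ (s - 1) * Real.exp (-l.re * t) * c) (Ioi 0) := by
  have := integrableOn_rpow_mul_exp_neg_mul_rpow (p := 1) (s := s - 1) (b := l.re)
    (by linarith) one_pos hl
  simp only [Real.rpow_one] at this
  exact this.mul_const c

theorem integrableOn_powIntegrand {l : ℂ} (hl : 0 < l.re) {s : ℝ} (hs : 0 < s) (x : X) :
    IntegrableOn (S.powIntegrand l s x) (Ioi 0) := by
  refine Integrable.mono' (integrableOn_powMajorant hl hs ‖x‖) ?_ ?_
  · refine ContinuousOn.aestronglyMeasurable (fun t ht => ?_) measurableSet_Ioi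
    refine ContinuousWithinAt.smul (ContinuousWithinAt.mul ?_ ?_)
      (S.continuous_orbit x).continuousWithinAt
    · exact (Complex.continuous_ofReal.continuousAt.comp
        (Real.continuousAt_rpow_const _ _ (Or.inl (ne_of_gt ht)))).continuousWithinAt
    · exact Continuous.continuousWithinAt (by fun_prop)
  · filter_upwards [ae_restrict_mem measurableSet_Ioi] with t ht
    exact S.norm_powIntegrand_le l s x ht

/-- The fractional power `(l - A) ^ (-s)` of the generator `A`, for `Re l > 0` and `s > 0`:
`(l - A) ^ (-s) x = Γ(s)⁻¹ ∫₀^∞ t ^ (s - 1) e ^ (-l t) S(t) x dt`. -/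
def negPow {l : ℂ} (hl : 0 < l.re) {s : ℝ} (hs : 0 < s) : X →L[ℂ] X :=
  LinearMap.mkContinuous
    { toFun := fun x => ((Real.Gamma s)⁻¹ : ℝ) • ∫ t in Ioi (0 : ℝ), S.powIntegrand l s x t
      map_add' := fun x y => by
        rw [← smul_add, ← integral_add (S.integrableOn_powIntegrand hl hs x)
          (S.integrableOn_powIntegrand hl hs y)]
        simp only [powIntegrand, map_add, smul_add]
      map_smul' := fun c x => by
        rw [RingHom.id_apply, smul_comm c, ← integral_smul c]
        simp only [powIntegrand, map_smul, smul_comm _ c] }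
    ((Real.Gamma s)⁻¹ * ∫ t in Ioi (0 : ℝ), t ^ (s - 1) * Real.exp (-l.re * t))
    fun x => by
      have hG : 0 < (Real.Gamma s)⁻¹ := inv_pos.2 (Real.Gamma_pos_of_pos hs)
      simp only [LinearMap.coe_mk, AddHom.coe_mk]
      rw [norm_smul, Real.norm_of_nonneg hG.le, mul_assoc, ← integral_mul_const]
      gcongr
      refine norm_integral_le_of_norm_le (integrableOn_powMajorant hl hs ‖x‖) ?_
      filter_upwards [ae_restrict_mem measurableSet_Ioi] with t ht
      exact S.norm_powIntegrand_le l s x ht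

theorem negPow_apply {l : ℂ} (hl : 0 < l.re) {s : ℝ} (hs : 0 < s) (x : X) :
    S.negPow hl hs x =
      ((Real.Gamma s)⁻¹ : ℝ) • ∫ t in Ioi (0 : ℝ), S.powIntegrand l s x t := rfl

theorem continuous_expOrbit (l : ℂ) (x : X) :
    Continuous fun u : ℝ => Complex.exp (-l * u) • S u.toNNReal x :=
  Continuous.smul (by fun_prop) (S.continuous_orbit x)

variable [CompleteSpace X]

theorem negPow_comm {l : ℂ} (hl : 0 < l.re) {s : ℝ} (hs : 0 < s) (L : X →L[ℂ] X)
    (hL : ∀ t z, L (S t z) = S t (L z)) (x : X) :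
    L (S.negPow hl hs x) = S.negPow hl hs (L x) := by
  rw [negPow_apply, negPow_apply, L.map_smul_of_tower,
    ← L.integral_comp_comm (S.integrableOn_powIntegrand hl hs x)]
  simp only [powIntegrand, map_smul, hL]

/-- `S t (l - A)⁻¹ x = e ^ (l t) ((l - A)⁻¹ x - ∫₀^t e ^ (-l u) S(u) x du)`. -/
theorem apply_negPow_one {l : ℂ} (hl : 0 < l.re) (x : X) {t : ℝ} (ht : 0 ≤ t) :
    S t.toNNReal (S.negPow hl one_pos x) = Complex.exp (l * t) •
      (S.negPow hl one_pos x - ∫ u in (0 : ℝ)..t, Complex.exp (-l * u) • S u.toNNReal x) := by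
  have hI := S.integrableOn_powIntegrand hl one_pos x
  have hpow : ∀ y : X, S.powIntegrand l 1 y = fun u : ℝ => Complex.exp (-l * u) • S u.toNNReal y := by
    intro y; funext u; simp [powIntegrand]
  rw [S.negPow_comm hl one_pos (S t.toNNReal) (fun _ _ => S.comm _ _ _), negPow_apply,
    negPow_apply]
  simp only [Real.Gamma_one, inv_one, one_smul]
  rw [hpow] at hI
  rw [hpow, hpow]
  have h1 : (∫ u in Ioi (0 : ℝ), Complex.exp (-l * u) • S u.toNNReal x) -
      ∫ u in (0 : ℝ)..t, Complex.exp (-l * u) • S u.toNNReal x =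
      ∫ u in Ioi t, Complex.exp (-l * u) • S u.toNNReal x := by
    rw [sub_eq_iff_eq_add, ← intervalIntegral.integral_Ioi_sub_Ioi hI ht]
    abel
  rw [h1]
  have h2 := (measurePreserving_add_right volume t).setIntegral_preimage_emb
    (measurableEmbedding_addRight t)
    (fun u : ℝ => Complex.exp (-l * u) • S u.toNNReal x) (Ioi t)
  rw [preimage_add_const_Ioi, sub_self] at h2
  rw [← h2, ← integral_smul]
  refine setIntegral_congr_fun measurableSet_Ioi fun u hu => ?_
  have hu' : (0 : ℝ) ≤ u := le_of_lt hu
  rw [smul_smul, ← Complex.exp_add, Real.toNNReal_add hu' ht, S.map_add',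
    ContinuousLinearMap.comp_apply]
  congr 2
  push_cast
  ring

theorem hasGenerator_negPow_one {l : ℂ} (hl : 0 < l.re) (x : X) :
    S.HasGenerator (S.negPow hl one_pos x) (l • S.negPow hl one_pos x - x) := by
  set R := S.negPow hl one_pos x with hR
  have hG : HasDerivAt (fun t : ℝ => ∫ u in (0 : ℝ)..t, Complex.exp (-l * u) • S u.toNNReal x)
      (Complex.exp (-l * (0 : ℝ)) • S (0 : ℝ).toNNReal x) 0 :=
    (S.continuous_expOrbit l x).integral_hasStrictDerivAt 0 0 |>.hasDerivAt
  have hE : HasDerivAt (fun t : ℝ => Complex.exp (l * t)) l 0 := by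
    have h1 : HasDerivAt (fun t : ℝ => l * (t : ℂ)) l 0 := by
      simpa using (Complex.ofRealCLM.hasDerivAt (x := (0 : ℝ))).const_mul l
    simpa using h1.cexp
  have hD := hE.smul ((hasDerivAt_const (0 : ℝ) R).sub hG)
  have hD' := hD.tendsto_slope_zero_right
  have h0 : S (Real.toNNReal 0) x = x := by simp [S.map_zero']
  simp only [zero_add] at hD'
  unfold HasGenerator
  simp only [h0, intervalIntegral.integral_same, Complex.ofReal_zero, mul_zero, Complex.exp_zero,
    one_smul, sub_zero, zero_sub, Pi.smul_apply', Pi.sub_apply] at hD'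
  have hval : -x + l • R = l • R - x := by abel
  rw [← hval]
  refine hD'.congr' ?_
  filter_upwards [self_mem_nhdsWithin] with t ht
  rw [hR, S.apply_negPow_one hl x (le_of_lt ht)]

/-- `(l - A) ((l - A)⁻¹ x) = x`. -/
theorem resolvent_right {l : ℂ} (hl : 0 < l.re) (x : X) :
    ∃ u : S.Domain, S.incl u = S.negPow hl one_pos x ∧ l • S.incl u - S.gen u = x := by
  have h := S.hasGenerator_negPow_one hl x
  refine ⟨⟨_, _, h⟩, rfl, ?_⟩
  rw [(S.hasGenerator' ⟨_, _, h⟩).unique h]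
  exact sub_sub_cancel _ _

/-- `(l - A)⁻¹ ((l - A) u) = u` for `u ∈ D(A)`. -/
theorem resolvent_left {l : ℂ} (hl : 0 < l.re) (u : S.Domain) :
    S.negPow hl one_pos (l • S.incl u - S.gen u) = S.incl u := by
  have h := (S.hasGenerator' u).map (S.negPow hl one_pos)
    fun t z => (S.negPow_comm hl one_pos (S t) (fun _ _ => S.comm _ _ _) z).symm
  have h' := h.unique (S.hasGenerator_negPow_one hl (S.incl u))
  rw [map_sub, map_smul, h', sub_sub_cancel]

theorem hasDerivAt_expOrbit {l : ℂ} (hl : 0 < l.re) (x : X) {t : ℝ} (ht : 0 < t) :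
    HasDerivAt (fun t : ℝ => Complex.exp (-l * t) • S t.toNNReal (S.negPow hl one_pos x))
      (-(Complex.exp (-l * t) • S t.toNNReal x)) t := by
  have hG : HasDerivAt (fun t : ℝ => ∫ u in (0 : ℝ)..t, Complex.exp (-l * u) • S u.toNNReal x)
      (Complex.exp (-l * t) • S t.toNNReal x) t :=
    (S.continuous_expOrbit l x).integral_hasStrictDerivAt 0 t |>.hasDerivAt
  have hD := (hasDerivAt_const t (S.negPow hl one_pos x)).sub hG
  rw [zero_sub] at hD
  refine hD.congr_of_eventuallyEq ?_
  filter_upwards [lt_mem_nhds ht] with r hr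
  rw [S.apply_negPow_one hl x hr.le, smul_smul, ← Complex.exp_add]
  simp

/-- `(l - A) ^ (-s) = (l - A)⁻¹ (l - A) ^ (-(s - 1))` for `s > 1`. -/
theorem negPow_eq {l : ℂ} (hl : 0 < l.re) {s : ℝ} (hs : 0 < s) (hs' : 0 < s - 1) (x : X) :
    S.negPow hl hs x = S.negPow hl one_pos (S.negPow hl hs' x) := by
  set R := S.negPow hl one_pos with hR
  rw [S.negPow_comm hl hs' R
    (fun t z => (S.negPow_comm hl one_pos (S t) (fun _ _ => S.comm _ _ _) z).symm)]
  have hi1 : IntegrableOn (fun t => (s - 1) • S.powIntegrand l (s - 1) (R x) t) (Ioi 0) :=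
    (S.integrableOn_powIntegrand hl hs' (R x)).smul (s - 1)
  have hi2 := S.integrableOn_powIntegrand hl hs x
  have key := integral_Ioi_of_hasDerivAt_of_tendsto (a := 0) (m := (0 : X))
    (f := fun t : ℝ => S.powIntegrand l s (R x) t)
    (f' := fun t : ℝ => (s - 1) • S.powIntegrand l (s - 1) (R x) t - S.powIntegrand l s x t)
    ?_ ?_ (hi1.sub hi2) ?_
  · have h0 : S.powIntegrand l s (R x) 0 = 0 := by
      simp [powIntegrand, Real.zero_rpow hs'.ne']
    rw [integral_sub hi1 hi2, integral_smul, h0, sub_zero, sub_eq_zero] at key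
    rw [negPow_apply, negPow_apply, ← key, smul_smul]
    congr 1
    have hGam : Real.Gamma s = (s - 1) * Real.Gamma (s - 1) := by
      have := Real.Gamma_add_one hs'.ne'
      rwa [sub_add_cancel] at this
    have := (Real.Gamma_pos_of_pos hs').ne'
    rw [hGam]
    field_simp
  · refine ContinuousWithinAt.smul (ContinuousWithinAt.mul ?_ ?_)
      (S.continuous_orbit _).continuousWithinAt
    · exact (Complex.continuous_ofReal.continuousAt.comp
        (Real.continuousAt_rpow_const _ _ (Or.inr hs'.le))).continuousWithinAt
    · exact Continuous.continuousWithinAt (by fun_prop)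
  · intro t ht
    have ht' : 0 < t := ht
    have h1 : HasDerivAt (fun t : ℝ => t ^ (s - 1)) ((s - 1) * t ^ (s - 1 - 1)) t :=
      Real.hasDerivAt_rpow_const (Or.inl ht'.ne')
    have h2 := h1.ofReal_comp.smul (S.hasDerivAt_expOrbit hl x ht')
    convert! h2 using 1
    · funext r
      simp [powIntegrand, mul_smul, hR]
    · simp only [powIntegrand, mul_smul, smul_neg, ← hR]
      rw [← Complex.coe_smul (s - 1)]
      simp only [Complex.ofReal_mul, mul_smul]
      abel
  · rw [tendsto_zero_iff_norm_tendsto_zero]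
    have h3 := (tendsto_rpow_mul_exp_neg_mul_atTop_nhds_zero (s - 1) l.re hl).mul_const ‖R x‖
    rw [zero_mul] at h3
    refine squeeze_zero' (Eventually.of_forall fun _ => norm_nonneg _) ?_ h3
    filter_upwards [eventually_gt_atTop 0] with t ht
    exact S.norm_powIntegrand_le l s _ ht

theorem exists_hasGenerator_negPow {l : ℂ} (hl : 0 < l.re) {s : ℝ} (hs : 1 ≤ s) :
    ∃ L : X →L[ℂ] X, ∀ x, S.HasGenerator (S.negPow hl (one_pos.trans_le hs) x) (L x) := by
  rcases hs.eq_or_lt with rfl | hs1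
  · exact ⟨l • S.negPow hl one_pos - ContinuousLinearMap.id ℂ X, S.hasGenerator_negPow_one hl⟩
  · refine ⟨l • S.negPow hl (one_pos.trans_le hs) - S.negPow hl (sub_pos.2 hs1), fun x => ?_⟩
    have h := S.hasGenerator_negPow_one hl (S.negPow hl (sub_pos.2 hs1) x)
    rw [← S.negPow_eq hl (one_pos.trans_le hs) (sub_pos.2 hs1)] at h
    exact h

/-- The operator `(l - A) ^ (-s)` for `s ≥ 1`, whose range lies in `D(A)`, as a bounded operator
from `X` to `D(A)` with the graph norm. -/
def negPowDomain {l : ℂ} (hl : 0 < l.re) {s : ℝ} (hs : 1 ≤ s) : X →L[ℂ] S.Domain :=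
  LinearMap.mkContinuousOfExistsBound
    (LinearMap.codRestrict S.generator.domain (S.negPow hl (one_pos.trans_le hs)).toLinearMap
      fun x => ⟨_, (S.exists_hasGenerator_negPow hl hs).choose_spec x⟩ : X →ₗ[ℂ] S.Domain) <| by
    obtain ⟨L, hL⟩ := S.exists_hasGenerator_negPow hl hs
    refine ⟨max ‖S.negPow hl (one_pos.trans_le hs)‖ ‖L‖, fun x => ?_⟩
    rw [domain_norm_def]
    refine max_le ?_ ?_
    · exact (S.negPow hl (one_pos.trans_le hs)).le_of_opNorm_le (le_max_left _ _) x
    · refine le_of_eq_of_le ?_ (L.le_of_opNorm_le (le_max_right _ _) x)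
      exact congrArg norm ((S.hasGenerator ⟨_, _, hL x⟩).unique (hL x))

theorem incl_negPowDomain {l : ℂ} (hl : 0 < l.re) {s : ℝ} (hs : 1 ≤ s) (x : X) :
    S.incl (S.negPowDomain hl hs x) = S.negPow hl (one_pos.trans_le hs) x := rfl

/-- The cogenerator `(I + A) (I - A)⁻¹`. -/
def cogenerator : X →L[ℂ] X :=
  (S.incl + S.gen).comp (S.negPowDomain (l := 1) (by simp) (le_refl 1))

end Powers

section Observation

variable {X Y : Type*} [NormedAddCommGroup X] [NormedSpace ℂ X]
  [NormedAddCommGroup Y] [NormedSpace ℂ Y] (S : ContractionSemigroup X)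

/-- `C ∈ L(D(A), Y)` is a `β`-admissible observation operator for the semigroup: there is `M > 0`
with `∫₀^∞ t ^ β ‖C S(t) x‖² dt ≤ M ‖x‖²` for all `x ∈ D(A)`. -/
def IsAdmissible (β : ℝ) (C : S.Domain →L[ℂ] Y) : Prop :=
  ∃ M : ℝ, 0 < M ∧ ∀ x : S.Domain,
    ∫⁻ t in Ioi (0 : ℝ), ENNReal.ofReal (t ^ β * ‖C (S.onDomain t.toNNReal x)‖ ^ 2) ≤
      ENNReal.ofReal (M * ‖S.incl x‖ ^ 2)

/-- The resolvent condition `sup_{Re l > 0} (Re l) ^ ((1 + β) / 2) ‖C (l - A) ^ (-(1 + β))‖ < ∞`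
for `(C, A)`. -/
def ResolventCondition [CompleteSpace X] {β : ℝ} (hβ : 0 ≤ β) (C : S.Domain →L[ℂ] Y) : Prop :=
  BddAbove {r : ℝ | ∃ (l : ℂ) (hl : 0 < l.re), r = l.re ^ ((1 + β) / 2) *
    ‖C.comp (S.negPowDomain hl (le_add_of_nonneg_right hβ : 1 ≤ 1 + β))‖}

/-- The operator `C (I - A) ^ (-(1 + β))` in `L(X, Y)`. -/
def discreteObservation [CompleteSpace X] {β : ℝ} (hβ : 0 ≤ β) (C : S.Domain →L[ℂ] Y) :
    X →L[ℂ] Y :=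
  C.comp (S.negPowDomain (l := 1) (by simp) (le_add_of_nonneg_right hβ : 1 ≤ 1 + β))

end Observation

end ContractionSemigroup

namespace DiscreteObservation

variable {X Y : Type*} [NormedAddCommGroup X] [NormedSpace ℂ X]
  [NormedAddCommGroup Y] [NormedSpace ℂ Y]

/-- `F ∈ L(X, Y)` is a `β`-admissible observation operator for `T ∈ L(X)`: there is `M > 0` with
`∑ₙ (1 + n) ^ β ‖F T ^ n x‖² ≤ M ‖x‖²` for all `x`. -/
def IsAdmissible (β : ℝ) (F : X →L[ℂ] Y) (T : X →L[ℂ] X) : Prop :=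
  ∃ M : ℝ, 0 < M ∧ ∀ x : X,
    ∑' n : ℕ, ENNReal.ofReal ((1 + (n : ℝ)) ^ β * ‖F ((T ^ n) x)‖ ^ 2) ≤
      ENNReal.ofReal (M * ‖x‖ ^ 2)

/-- The power `(I + B) ^ a`, given by the binomial series `∑ₙ (a choose n) B ^ n`, which converges
in operator norm for `‖B‖ < 1`. -/
def oneAddPow (B : X →L[ℂ] X) (a : ℂ) : X →L[ℂ] X :=
  (binomialSeries (X →L[ℂ] X) a).sum B

/-- The resolvent condition
`sup_{|z| < 1} (1 - |z|²) ^ ((1 + β) / 2) ‖F (I - conj z T) ^ (-β - 1)‖ < ∞` for `(F, T)`, where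
`T` is a contraction. -/
def ResolventCondition (β : ℝ) (F : X →L[ℂ] Y) (T : X →L[ℂ] X) : Prop :=
  BddAbove {r : ℝ | ∃ z : ℂ, ‖z‖ < 1 ∧ r = (1 - ‖z‖ ^ 2) ^ ((1 + β) / 2) *
    ‖F.comp (oneAddPow (-(starRingEnd ℂ z • T)) (-(β : ℂ) - 1))‖}

end DiscreteObservation

end

/-!
Put `s = 1 + β` and `R = (I - A)⁻¹`, so that `T = 2 R - I`. Both equivalences hold because the
objects attached to `T` are explicit transforms of those attached to the semigroup.

*Admissibility.* Every `x ∈ D(A)` is `R z` for some `z`, and its output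
`f(t) = C S(t) x = (C R) S(t) z` is bounded and continuous. The binomial theorem and
`R ^ j (I - A) ^ (-s) = (I - A) ^ (-(s + j))` give
`F T ^ n x = (-1) ^ n ∫₀^∞ t ^ (s - 1) e ^ (-t) q_n(t) f(t) dt`, where `q_n` is a multiple of the
Laguerre polynomial `L_n ^ (s - 1) (2 t)` (`norm_sq_discreteObservation_cogenerator_pow`). The
functions `t ^ ((s - 1) / 2) e ^ (-t) q_n(t)` are orthogonal in `L²(0, ∞)`, with squared norms
`n! / (2 ^ s Γ(n + s))` comparable to `(1 + n) ^ (-β)`. Hence `∑ (1 + n) ^ β ‖F T ^ n x‖²` and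
`∫ t ^ β ‖f‖²` are comparable. One bound is Bessel's inequality
(`tsum_le_lintegral_rpow_mul_norm_sq`), extended from `D(A)` to the whole space by density. The
other (`lintegral_rpow_mul_norm_sq_le_tsum`) must not presuppose that `t ^ (β / 2) f` is square
integrable: the Laguerre coefficients are square summable and thus belong to some `g` in `L²`, and
all moments of the difference of `t ^ (β / 2) f` and `g` against `t ^ (β / 2) e ^ (-t)` vanish, so
the two functions agree because a function with an exponential moment is determined by its moments
(`ae_eq_zero_of_forall_moment_eq_zero`).

*Resolvent conditions.* For `|w| < 1` and `l = (1 - w) / (1 + w)` one has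
`(I - w T) ^ (-s) (I - A) ^ (-s) = (1 + w) ^ (-s) (l - A) ^ (-s)`
(`oneAddPow_cogenerator_negPow`): the right hand side is holomorphic in `w` and solves
`(I - w T) U' = s T U`, which forces its Taylor coefficients to be those of the binomial series.
Since `Re l = (1 - |w|²) / |1 + w|²`, the two suprema are over the same set of numbers.
-/

/-! ### Laguerre polynomials -/

/-- The Laguerre polynomial `L_n^(s-1)(2t)`, normalised by the factor `n! / Γ(s + n)`:
`∑ⱼ (-1)^j (n choose j) (2t)^j / Γ(s + j)`. -/
noncomputable def laguerre (s : ℝ) (n : ℕ) (t : ℝ) : ℝ :=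
  ∑ j ∈ Finset.range (n + 1), (-1) ^ j * (n.choose j) * (2 * t) ^ j / Real.Gamma (s + j)

/-- The squared norm of `laguerre s n` in `L²((0, ∞), t^(s-1) e^(-2t) dt)`. -/
noncomputable def laguerreNormSq (s : ℝ) (n : ℕ) : ℝ :=
  n.factorial / (2 ^ s * Real.Gamma (s + n))

theorem laguerreNormSq_pos {s : ℝ} (hs : 0 < s) (n : ℕ) : 0 < laguerreNormSq s n := by
  have := Real.Gamma_pos_of_pos (s := s + n) (by positivity)
  unfold laguerreNormSq
  positivity

theorem continuous_laguerre (s : ℝ) (n : ℕ) : Continuous (laguerre s n) := by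
  unfold laguerre; fun_prop

theorem Gamma_add_natCast {x : ℝ} (hx : 0 < x) (k : ℕ) :
    Real.Gamma (x + k) = (ascPochhammer ℝ k).eval x * Real.Gamma x := by
  induction k with
  | zero => simp
  | succ k ih =>
    have : x + k ≠ 0 := by positivity
    rw [Nat.cast_succ, ← add_assoc, Real.Gamma_add_one this, ih, ascPochhammer_succ_eval]
    ring

/-- An alternating binomial sum is an `n`-th finite difference, and so vanishes on polynomials of
degree less than `n`. -/
theorem sum_choose_mul_eval_eq_fwdDiff (P : Polynomial ℝ) (n : ℕ) (y : ℝ) :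
    ∑ j ∈ Finset.range (n + 1), (-1) ^ j * (n.choose j) * P.eval (y + j) =
      (-1) ^ n * (fwdDiff 1)^[n] (fun x => P.eval x) y := by
  rw [fwdDiff_iter_eq_sum_shift, Finset.mul_sum]
  refine Finset.sum_congr rfl fun j hj => ?_
  have hj' : j ≤ n := Nat.lt_succ_iff.1 (Finset.mem_range.1 hj)
  obtain ⟨m, rfl⟩ := Nat.exists_eq_add_of_le hj'
  rw [Nat.add_sub_cancel_left, zsmul_eq_mul, nsmul_eq_mul, mul_one]
  push_cast
  have : ((-1 : ℝ) ^ m) * (-1) ^ m = 1 := by rw [← mul_pow]; simp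
  rw [pow_add]
  linear_combination (-((-1) ^ j * ((j + m).choose j : ℝ) * Polynomial.eval (y + ↑j) P)) * this

theorem integrableOn_rpow_mul_exp_mul_pow {s r : ℝ} (hs : 0 < s) (hr : 0 < r) (k : ℕ) :
    IntegrableOn (fun t : ℝ => t ^ (s - 1) * Real.exp (-(r * t)) * t ^ k) (Ioi 0) := by
  have := integrableOn_rpow_mul_exp_neg_mul_rpow (p := 1) (s := s + k - 1) (b := r)
    (by have : (0 : ℝ) ≤ k := by positivity
        linarith) one_pos hr
  refine this.congr_fun (fun t ht => ?_) measurableSet_Ioi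
  have ht : (0 : ℝ) < t := ht
  simp only [Real.rpow_one, neg_mul]
  rw [show s + k - 1 = s - 1 + k by ring, Real.rpow_add ht, Real.rpow_natCast]
  ring

theorem integral_rpow_mul_exp_mul_pow {s r : ℝ} (hs : 0 < s) (hr : 0 < r) (k : ℕ) :
    ∫ t in Ioi (0 : ℝ), t ^ (s - 1) * Real.exp (-(r * t)) * t ^ k =
      Real.Gamma (s + k) / (r ^ s * r ^ k) := by
  have := Real.integral_rpow_mul_exp_neg_mul_Ioi (a := s + k) (r := r) (by positivity) hr
  rw [one_div, Real.inv_rpow hr.le, Real.rpow_add hr, Real.rpow_natCast] at this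
  rw [div_eq_inv_mul, ← this]
  refine setIntegral_congr_fun measurableSet_Ioi fun t ht => ?_
  have ht : (0 : ℝ) < t := ht
  rw [show s + k - 1 = s - 1 + k by ring, Real.rpow_add ht, Real.rpow_natCast]
  ring

/-- The moments of the Laguerre polynomial are finite differences of `Γ(x + k) / Γ(x)`, a
polynomial in `x` of degree `k`. -/
theorem integral_laguerre_mul_pow {s : ℝ} (hs : 0 < s) (n k : ℕ) :
    ∫ t in Ioi (0 : ℝ), t ^ (s - 1) * Real.exp (-(2 * t)) * (laguerre s n t * t ^ k) =
      (-1) ^ n * (fwdDiff 1)^[n] (fun x => (ascPochhammer ℝ k).eval x) s / (2 ^ s * 2 ^ k) := by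
  rw [← sum_choose_mul_eval_eq_fwdDiff, Finset.sum_div]
  simp only [laguerre, Finset.sum_mul, Finset.mul_sum]
  have e : ∀ (j : ℕ) (t : ℝ), t ^ (s - 1) * Real.exp (-(2 * t)) *
      ((-1) ^ j * (n.choose j) * (2 * t) ^ j / Real.Gamma (s + j) * t ^ k) =
      ((-1) ^ j * (n.choose j) * 2 ^ j / Real.Gamma (s + j)) *
        (t ^ (s - 1) * Real.exp (-(2 * t)) * t ^ (j + k)) := by
    intro j t; rw [mul_pow, pow_add]; ring
  simp only [e]
  rw [integral_finsetSum _ fun j _ =>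
    (integrableOn_rpow_mul_exp_mul_pow hs two_pos (j + k)).const_mul _]
  refine Finset.sum_congr rfl fun j _ => ?_
  have hG := (Real.Gamma_pos_of_pos (s := s + j) (by positivity)).ne'
  rw [integral_const_mul, integral_rpow_mul_exp_mul_pow hs two_pos, Nat.cast_add, ← add_assoc,
    Gamma_add_natCast (x := s + j) (by positivity), pow_add]
  field_simp

theorem integral_laguerre_mul_pow_of_lt {s : ℝ} (hs : 0 < s) {n k : ℕ} (hk : k < n) :
    ∫ t in Ioi (0 : ℝ), t ^ (s - 1) * Real.exp (-(2 * t)) * (laguerre s n t * t ^ k) = 0 := by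
  rw [integral_laguerre_mul_pow hs,
    Polynomial.fwdDiff_iter_eq_zero_of_degree_lt (by rwa [ascPochhammer_natDegree])]
  simp

theorem integral_laguerre_mul_pow_self {s : ℝ} (hs : 0 < s) (n : ℕ) :
    ∫ t in Ioi (0 : ℝ), t ^ (s - 1) * Real.exp (-(2 * t)) * (laguerre s n t * t ^ n) =
      (-1) ^ n * n.factorial / (2 ^ s * 2 ^ n) := by
  have h := Polynomial.fwdDiff_iter_degree_eq_factorial (ascPochhammer ℝ n)
  rw [ascPochhammer_natDegree, (monic_ascPochhammer ℝ n).leadingCoeff, one_smul] at h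
  rw [integral_laguerre_mul_pow hs, h]
  simp

theorem integrableOn_laguerre_mul_pow {s r : ℝ} (hs : 0 < s) (hr : 0 < r) (n k : ℕ) :
    IntegrableOn (fun t : ℝ => t ^ (s - 1) * Real.exp (-(r * t)) * (laguerre s n t * t ^ k))
      (Ioi 0) := by
  have e : (fun t : ℝ => t ^ (s - 1) * Real.exp (-(r * t)) * (laguerre s n t * t ^ k)) =
      fun t => ∑ j ∈ Finset.range (n + 1), ((-1) ^ j * (n.choose j) * 2 ^ j / Real.Gamma (s + j)) *
        (t ^ (s - 1) * Real.exp (-(r * t)) * t ^ (j + k)) := by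
    funext t
    simp only [laguerre, Finset.sum_mul, Finset.mul_sum]
    refine Finset.sum_congr rfl fun j _ => ?_
    rw [mul_pow, pow_add]; ring
  rw [e]
  exact integrable_finsetSum _ fun j _ =>
    (integrableOn_rpow_mul_exp_mul_pow hs hr (j + k)).const_mul _

theorem laguerre_mul_laguerre_expand (s : ℝ) (r : ℝ) (n m : ℕ) :
    (fun t : ℝ => t ^ (s - 1) * Real.exp (-(r * t)) * (laguerre s n t * laguerre s m t)) =
      fun t => ∑ j ∈ Finset.range (m + 1), ((-1) ^ j * (m.choose j) * 2 ^ j / Real.Gamma (s + j)) *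
        (t ^ (s - 1) * Real.exp (-(r * t)) * (laguerre s n t * t ^ j)) := by
  funext t
  rw [laguerre.eq_1 s m]
  simp only [Finset.mul_sum]
  refine Finset.sum_congr rfl fun j _ => ?_
  rw [mul_pow]; ring

theorem integrableOn_laguerre_mul_laguerre {s r : ℝ} (hs : 0 < s) (hr : 0 < r) (n m : ℕ) :
    IntegrableOn
      (fun t : ℝ => t ^ (s - 1) * Real.exp (-(r * t)) * (laguerre s n t * laguerre s m t))
      (Ioi 0) := by
  rw [laguerre_mul_laguerre_expand]
  exact integrable_finsetSum _ fun j _ => (integrableOn_laguerre_mul_pow hs hr n j).const_mul _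

theorem integral_laguerre_mul_laguerre_of_lt {s : ℝ} (hs : 0 < s) {n m : ℕ} (h : m < n) :
    ∫ t in Ioi (0 : ℝ), t ^ (s - 1) * Real.exp (-(2 * t)) * (laguerre s n t * laguerre s m t) =
      0 := by
  rw [laguerre_mul_laguerre_expand, integral_finsetSum _ fun j _ =>
    (integrableOn_laguerre_mul_pow hs two_pos n j).const_mul _]
  refine Finset.sum_eq_zero fun j hj => ?_
  rw [integral_const_mul, integral_laguerre_mul_pow_of_lt hs (by grind), mul_zero]

theorem integral_laguerre_mul_laguerre_of_ne {s : ℝ} (hs : 0 < s) {n m : ℕ} (h : n ≠ m) :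
    ∫ t in Ioi (0 : ℝ), t ^ (s - 1) * Real.exp (-(2 * t)) * (laguerre s n t * laguerre s m t) =
      0 := by
  rcases h.lt_or_gt with h | h
  · simpa only [mul_comm (laguerre s n _)] using integral_laguerre_mul_laguerre_of_lt hs h
  · exact integral_laguerre_mul_laguerre_of_lt hs h

theorem integral_laguerre_mul_self {s : ℝ} (hs : 0 < s) (n : ℕ) :
    ∫ t in Ioi (0 : ℝ), t ^ (s - 1) * Real.exp (-(2 * t)) * (laguerre s n t * laguerre s n t) =
      laguerreNormSq s n := by
  rw [laguerre_mul_laguerre_expand, integral_finsetSum _ fun j _ =>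
    (integrableOn_laguerre_mul_pow hs two_pos n j).const_mul _, Finset.sum_range_succ,
    Finset.sum_eq_zero, zero_add]
  · have hG := (Real.Gamma_pos_of_pos (s := s + n) (by positivity)).ne'
    have : ((-1 : ℝ) ^ n) * (-1) ^ n = 1 := by rw [← mul_pow]; simp
    rw [integral_const_mul, integral_laguerre_mul_pow_self hs, laguerreNormSq, Nat.choose_self]
    field_simp
    rw [mul_comm, sq, this]; simp
  · intro j hj
    rw [integral_const_mul, integral_laguerre_mul_pow_of_lt hs (by grind), mul_zero]

/-- `Γ(n + 1 + β) / n!` is comparable to `(1 + n) ^ β`, by Euler's limit formula for `Γ(β)`. -/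
theorem exists_rpow_mul_laguerreNormSq_bounds {β : ℝ} (hβ : 0 < β) :
    ∃ a b : ℝ, 0 < a ∧ 0 < b ∧ ∀ n : ℕ,
      a ≤ (1 + (n : ℝ)) ^ β * laguerreNormSq (1 + β) n ∧
      (1 + (n : ℝ)) ^ β * laguerreNormSq (1 + β) n ≤ b := by
  set u : ℕ → ℝ := fun n => (1 + (n : ℝ)) ^ β * laguerreNormSq (1 + β) n with hu
  have hpos : ∀ n, 0 < u n := fun n => by
    have := laguerreNormSq_pos (s := 1 + β) (by positivity) n
    positivity
  have hprod : ∀ n : ℕ, Real.Gamma (1 + β + n) =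
      Real.Gamma β * ∏ j ∈ Finset.range (n + 1), (β + j) := by
    intro n
    induction n with
    | zero => rw [add_comm 1 β]; simp [Real.Gamma_add_one hβ.ne', mul_comm]
    | succ n ih =>
      rw [Finset.prod_range_succ, ← mul_assoc, ← ih, Nat.cast_succ, ← add_assoc,
        Real.Gamma_add_one (by positivity)]
      ring
  -- The sequence is positive with a positive limit, so it and its inverse are bounded.
  have hlim : Tendsto u atTop (𝓝 (1 / 2 ^ (1 + β))) := by
    have h1 := (Real.GammaSeq_tendsto_Gamma β).div_const (Real.Gamma β)
    have hG := (Real.Gamma_pos_of_pos hβ).ne'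
    rw [div_self hG] at h1
    have h2 : Tendsto (fun n : ℕ => ((1 + (n : ℝ)) / n) ^ β) atTop (𝓝 1) := by
      have : Tendsto (fun n : ℕ => (1 + (n : ℝ)) / n) atTop (𝓝 1) := by
        have h3 := (tendsto_one_div_atTop_nhds_zero_nat (𝕜 := ℝ)).add_const 1
        rw [zero_add] at h3
        refine h3.congr' ?_
        filter_upwards [eventually_gt_atTop 0] with n hn
        field_simp
      simpa using this.rpow_const (p := β) (Or.inl one_ne_zero)
    have h4 := (h2.mul h1).div_const ((2 : ℝ) ^ (1 + β))
    rw [mul_one] at h4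
    refine h4.congr' ?_
    filter_upwards [eventually_gt_atTop 0] with n hn
    have hn' : (0 : ℝ) < n := by exact_mod_cast hn
    have : (0 : ℝ) < ∏ j ∈ Finset.range (n + 1), (β + j) :=
      Finset.prod_pos fun j _ => by positivity
    simp only [hu, laguerreNormSq, hprod, Real.GammaSeq]
    rw [Real.div_rpow (by positivity) hn'.le]
    field_simp
  obtain ⟨b, hb⟩ := hlim.bddAbove_range
  have hlim' := hlim.inv₀ (by positivity)
  obtain ⟨a, ha⟩ := hlim'.bddAbove_range
  have ha0 : 0 < a := (inv_pos.2 (hpos 0)).trans_le (ha ⟨0, rfl⟩)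
  refine ⟨a⁻¹, b, inv_pos.2 ha0, (hpos 0).trans_le (hb ⟨0, rfl⟩), fun n => ⟨?_, hb ⟨n, rfl⟩⟩⟩
  exact inv_le_of_inv_le₀ (hpos n) (ha ⟨n, rfl⟩)

/-! ### The Laplace transform and determination by moments -/

section Laplace

variable {E : Type*} [NormedAddCommGroup E] [NormedSpace ℂ E]

/-- The `k`-th derivative `∫₀^∞ t^k e^(zt) u(t) dt` of the Laplace transform of `u`, with the sign
convention `e^(zt)`: it converges on a left half plane. -/
noncomputable def laplaceMoment (u : ℝ → E) (k : ℕ) (z : ℂ) : E :=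
  ∫ t in Ioi (0 : ℝ), ((t : ℂ) ^ k * Complex.exp (z * t)) • u t

theorem pow_mul_exp_le {ε t : ℝ} (hε : 0 < ε) (ht : 0 ≤ t) (k : ℕ) (r : ℝ) :
    t ^ k * Real.exp (r * t) ≤ k.factorial / ε ^ k * Real.exp ((r + ε) * t) := by
  have h := Real.pow_div_factorial_le_exp (ε * t) (by positivity) k
  rw [div_le_iff₀ (by positivity), mul_pow] at h
  rw [add_mul, Real.exp_add, div_mul_eq_mul_div, le_div_iff₀ (by positivity)]
  nlinarith [mul_le_mul_of_nonneg_left h (Real.exp_pos (r * t)).le]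

theorem norm_laplaceIntegrand_le {ε r t : ℝ} (hε : 0 < ε) (ht : 0 ≤ t) (k : ℕ) {z : ℂ}
    (hz : z.re ≤ r) (x : E) :
    ‖((t : ℂ) ^ k * Complex.exp (z * t)) • x‖ ≤
      k.factorial / ε ^ k * ‖Real.exp ((r + ε) * t) • x‖ := by
  rw [norm_smul, norm_smul, norm_mul, norm_pow, Complex.norm_real, Complex.norm_exp,
    Real.norm_of_nonneg ht, Real.norm_of_nonneg (Real.exp_pos _).le, ← mul_assoc]
  refine mul_le_mul_of_nonneg_right ?_ (norm_nonneg _)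
  refine le_trans ?_ (pow_mul_exp_le hε ht k r)
  have : (z * (t : ℂ)).re = z.re * t := by simp
  rw [this]
  gcongr

variable {u : ℝ → E} {δ : ℝ}

theorem aestronglyMeasurable_laplaceIntegrand
    (hm : AEStronglyMeasurable u (volume.restrict (Ioi 0))) (k : ℕ) (z : ℂ) :
    AEStronglyMeasurable (fun t : ℝ => ((t : ℂ) ^ k * Complex.exp (z * t)) • u t)
      (volume.restrict (Ioi 0)) :=
  AEStronglyMeasurable.smul (Continuous.aestronglyMeasurable (by fun_prop)) hm

theorem integrableOn_laplaceIntegrand (hm : AEStronglyMeasurable u (volume.restrict (Ioi 0)))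
    (hu : ∀ r < δ, IntegrableOn (fun t => Real.exp (r * t) • u t) (Ioi 0)) (k : ℕ) {z : ℂ}
    (hz : z.re < δ) :
    IntegrableOn (fun t : ℝ => ((t : ℂ) ^ k * Complex.exp (z * t)) • u t) (Ioi 0) := by
  have hε : 0 < (δ - z.re) / 2 := by linarith
  refine Integrable.mono' ((hu (z.re + (δ - z.re) / 2) (by linarith)).norm.const_mul
    (k.factorial / ((δ - z.re) / 2) ^ k)) (aestronglyMeasurable_laplaceIntegrand hm k z) ?_
  filter_upwards [ae_restrict_mem measurableSet_Ioi] with t ht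
  exact norm_laplaceIntegrand_le hε (le_of_lt ht) k le_rfl _

theorem hasDerivAt_laplaceMoment (hm : AEStronglyMeasurable u (volume.restrict (Ioi 0)))
    (hu : ∀ r < δ, IntegrableOn (fun t => Real.exp (r * t) • u t) (Ioi 0)) (k : ℕ) {z : ℂ}
    (hz : z.re < δ) :
    HasDerivAt (laplaceMoment u k) (laplaceMoment u (k + 1) z) z := by
  have hε : 0 < (δ - z.re) / 3 := by linarith
  have hs : {w : ℂ | w.re < z.re + (δ - z.re) / 3} ∈ 𝓝 z :=
    (isOpen_lt Complex.continuous_re continuous_const).mem_nhds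
      (show z.re < z.re + (δ - z.re) / 3 by linarith)
  refine (hasDerivAt_integral_of_dominated_loc_of_deriv_le
    (F := fun (z : ℂ) (t : ℝ) => ((t : ℂ) ^ k * Complex.exp (z * t)) • u t)
    (F' := fun (z : ℂ) (t : ℝ) => ((t : ℂ) ^ (k + 1) * Complex.exp (z * t)) • u t)
    (bound := fun t => (k + 1).factorial / ((δ - z.re) / 3) ^ (k + 1) *
      ‖Real.exp ((z.re + (δ - z.re) / 3 + (δ - z.re) / 3) * t) • u t‖) hs
    (Eventually.of_forall fun w => aestronglyMeasurable_laplaceIntegrand hm k w)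
    (integrableOn_laplaceIntegrand hm hu k hz) (aestronglyMeasurable_laplaceIntegrand hm _ z)
    ?_ ((hu _ (by linarith)).norm.const_mul _) ?_).2
  · filter_upwards [ae_restrict_mem measurableSet_Ioi] with t ht w hw
    exact norm_laplaceIntegrand_le hε (le_of_lt ht) _ (le_of_lt hw) _
  · refine Eventually.of_forall fun t w _ => ?_
    have h1 : HasDerivAt (fun w : ℂ => w * (t : ℂ)) (t : ℂ) w := by
      simpa using (hasDerivAt_id w).mul_const (t : ℂ)
    convert! (h1.cexp.const_mul ((t : ℂ) ^ k)).smul_const (u t) using 2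
    ring

theorem iteratedDeriv_laplaceMoment (hm : AEStronglyMeasurable u (volume.restrict (Ioi 0)))
    (hu : ∀ r < δ, IntegrableOn (fun t => Real.exp (r * t) • u t) (Ioi 0)) (k : ℕ) {z : ℂ}
    (hz : z.re < δ) :
    iteratedDeriv k (laplaceMoment u 0) z = laplaceMoment u k z := by
  induction k generalizing z with
  | zero => simp
  | succ k ih =>
    rw [iteratedDeriv_succ]
    have h : iteratedDeriv k (laplaceMoment u 0) =ᶠ[𝓝 z] laplaceMoment u k := by
      filter_upwards [(isOpen_lt Complex.continuous_re continuous_const).mem_nhds hz] with w hw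
      exact ih hw
    rw [h.deriv_eq, (hasDerivAt_laplaceMoment hm hu k hz).deriv]

variable [CompleteSpace E]

theorem laplaceMoment_eq_zero_of_forall_moment
    (hm : AEStronglyMeasurable u (volume.restrict (Ioi 0))) (hδ : 0 < δ)
    (hu : ∀ r < δ, IntegrableOn (fun t => Real.exp (r * t) • u t) (Ioi 0))
    (h0 : ∀ k : ℕ, ∫ t in Ioi (0 : ℝ), t ^ k • u t = 0) {z : ℂ} (hz : z.re < δ) :
    laplaceMoment u 0 z = 0 := by
  have hopen : IsOpen {w : ℂ | w.re < δ} := isOpen_lt Complex.continuous_re continuous_const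
  have hd : DifferentiableOn ℂ (laplaceMoment u 0) {w : ℂ | w.re < δ} := fun w hw =>
    (hasDerivAt_laplaceMoment hm hu 0 hw).differentiableAt.differentiableWithinAt
  have hsub : Metric.ball (0 : ℂ) δ ⊆ {w : ℂ | w.re < δ} := fun w hw =>
    (Complex.re_le_norm w).trans_lt (by simpa using hw)
  have hloc : ∀ w ∈ Metric.ball (0 : ℂ) δ, laplaceMoment u 0 w = 0 := fun w hw => by
    have h := Complex.hasSum_taylorSeries_on_ball (hd.mono hsub) hw
    refine h.unique ?_
    convert hasSum_zero (α := E) (β := ℕ) with k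
    rw [iteratedDeriv_laplaceMoment hm hu k (by simpa using hδ)]
    have : laplaceMoment u k 0 = 0 := by
      rw [← h0 k]
      refine integral_congr_ae (Eventually.of_forall fun t => ?_)
      simp only [zero_mul, Complex.exp_zero, mul_one]
      rw [← Complex.coe_smul, Complex.ofReal_pow]
    simp [this]
  exact (hd.analyticOnNhd hopen).eqOn_zero_of_preconnected_of_eventuallyEq_zero
    (convex_halfSpace_re_lt δ).isPreconnected (show (0 : ℂ).re < δ by simpa using hδ)
    (Filter.mem_of_superset (Metric.ball_mem_nhds 0 hδ) hloc) hz

/-- The Fourier transform is symmetric for the pairing of functions, so `v` annihilates every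
Fourier transform of a Schwartz function once its own transform vanishes. -/
theorem integral_fourier_smul_eq_zero (ψ : SchwartzMap ℝ ℂ) {v : ℝ → E} (hv : Integrable v)
    (h : ∀ ξ, FourierTransform.fourier v ξ = 0) :
    ∫ t, FourierTransform.fourier (ψ : ℝ → ℂ) t • v t = 0 := by
  have key := VectorFourier.integral_fourierIntegral_smul_eq_flip (L := innerₗ ℝ)
    (μ := volume) (ν := volume) (f := (ψ : ℝ → ℂ)) (g := v)
    Real.continuous_fourierChar continuous_inner ψ.integrable hv
  refine key.trans ?_
  rw [flip_innerₗ]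
  have : ∀ t, VectorFourier.fourierIntegral Real.fourierChar volume (innerₗ ℝ) v t = 0 := h
  simp [this]

theorem integral_contDiff_smul_eq_zero_of_fourier_eq_zero {v : ℝ → E} (hv : Integrable v)
    (h : ∀ ξ, FourierTransform.fourier v ξ = 0) (g : ℝ → ℝ) (hg : ContDiff ℝ (⊤ : ℕ∞) g)
    (hc : HasCompactSupport g) : ∫ t, g t • v t = 0 := by
  have hc' : HasCompactSupport (Complex.ofRealCLM ∘ g) := hc.comp_left rfl
  have hg' : ContDiff ℝ (⊤ : ℕ∞) (Complex.ofRealCLM ∘ g) := by fun_prop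
  obtain ⟨φ, hφ⟩ : ∃ φ : SchwartzMap ℝ ℂ, ∀ t, φ t = (g t : ℂ) :=
    ⟨hc'.toSchwartzMap hg', fun t => by simp⟩
  have key := integral_fourier_smul_eq_zero (FourierTransformInv.fourierInv φ) hv h
  rw [← SchwartzMap.fourier_coe, FourierTransform.fourier_fourierInv_eq] at key
  simpa [hφ] using key

/-- An integrable function with vanishing Fourier transform vanishes almost everywhere. -/
theorem ae_eq_zero_of_fourier_eq_zero {v : ℝ → E} (hv : Integrable v)
    (h : ∀ ξ, FourierTransform.fourier v ξ = 0) : ∀ᵐ t, v t = 0 :=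
  ae_eq_zero_of_integral_contDiff_smul_eq_zero hv.locallyIntegrable
    (integral_contDiff_smul_eq_zero_of_fourier_eq_zero hv h)

/-- A function on `(0, ∞)` with an exponential moment is determined by its moments: its Laplace
transform, holomorphic near the closed left half plane, has zero Taylor series at the origin, so
its Fourier transform vanishes. -/
theorem ae_eq_zero_of_forall_moment_eq_zero
    (hm : AEStronglyMeasurable u (volume.restrict (Ioi 0))) (hδ : 0 < δ)
    (hu : ∀ r < δ, IntegrableOn (fun t => Real.exp (r * t) • u t) (Ioi 0))
    (h0 : ∀ k : ℕ, ∫ t in Ioi (0 : ℝ), t ^ k • u t = 0) :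
    ∀ᵐ t ∂volume.restrict (Ioi (0 : ℝ)), u t = 0 := by
  have hi : IntegrableOn u (Ioi 0) := by simpa using hu 0 hδ
  have h := ae_eq_zero_of_fourier_eq_zero (v := (Ioi (0 : ℝ)).indicator u)
    ((integrable_indicator_iff measurableSet_Ioi).2 hi) fun ξ => by
      have hL := laplaceMoment_eq_zero_of_forall_moment hm hδ hu h0
        (z := ((-2 * Real.pi * ξ : ℝ) : ℂ) * Complex.I) (by simpa using hδ)
      rw [Real.fourier_real_eq_integral_exp_smul, ← hL, laplaceMoment,
        ← integral_indicator measurableSet_Ioi]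
      refine integral_congr_ae (Eventually.of_forall fun t => ?_)
      by_cases ht : t ∈ Ioi (0 : ℝ)
      · simp only [indicator_of_mem ht, pow_zero, one_mul]
        congr 2
        push_cast
        ring
      · simp [indicator_of_notMem ht]
  rw [ae_restrict_iff' measurableSet_Ioi]
  filter_upwards [h] with t ht hmem
  simpa [indicator_of_mem hmem] using ht

end Laplace

/-! ### Vector-valued expansions along an orthonormal sequence of scalar functions -/

section OrthonormalSequence

variable {α : Type*} [MeasurableSpace α] {μ : Measure α}
  {Y : Type*} [NormedAddCommGroup Y] [InnerProductSpace ℂ Y]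

theorem lintegral_norm_sq_eq_norm_toLp_sq {g : α → Y} (hg : MemLp g 2 μ) :
    ∫⁻ t, ENNReal.ofReal (‖g t‖ ^ 2) ∂μ = ENNReal.ofReal (‖hg.toLp g‖ ^ 2) := by
  rw [← ofReal_integral_eq_lintegral_ofReal ((memLp_two_iff_integrable_sq_norm hg.1).1 hg)
    (Eventually.of_forall fun _ => by positivity)]
  congr 1
  rw [← inner_self_eq_norm_sq (𝕜 := ℂ), L2.inner_def, ← integral_re (L2.integrable_inner _ _)]
  refine integral_congr_ae ?_
  filter_upwards [hg.coeFn_toLp] with t ht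
  rw [ht, inner_self_eq_norm_sq]

theorem memLp_two_smul_const {φ : α → ℝ} (hφ : MemLp φ 2 μ) (y : Y) :
    MemLp (fun t => φ t • y) 2 μ := by
  rw [memLp_two_iff_integrable_sq_norm (hφ.1.smul_const y)]
  have h := ((memLp_two_iff_integrable_sq hφ.1).1 hφ).mul_const (‖y‖ ^ 2)
  refine h.congr (Eventually.of_forall fun t => ?_)
  simp [norm_smul, mul_pow]

theorem integrable_smul_of_memLp_two {φ : α → ℝ} (hφ : MemLp φ 2 μ) {f : α → Y}
    (hf : MemLp f 2 μ) : Integrable (fun t => φ t • f t) μ := by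
  have h : MemLp (φ • f) 1 μ := hf.smul hφ
  exact memLp_one_iff_integrable.1 h

/-- The map `y ↦ φ ⊗ y` from `Y` to `L²(μ; Y)`, for `φ` of norm one in `L²(μ)`. -/
noncomputable def tensorIsometry {φ : α → ℝ} (hφ : MemLp φ 2 μ) (h1 : ∫ t, φ t * φ t ∂μ = 1) :
    Y →ₗᵢ[ℂ] Lp Y 2 μ where
  toFun y := (memLp_two_smul_const hφ y).toLp
  map_add' y z := by
    rw [← MemLp.toLp_add]
    exact MemLp.toLp_congr _ _ (Eventually.of_forall fun t => by simp)
  map_smul' c y := by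
    rw [RingHom.id_apply, ← MemLp.toLp_const_smul]
    exact MemLp.toLp_congr _ _ (Eventually.of_forall fun t => smul_comm _ _ _)
  norm_map' y := by
    have h := lintegral_norm_sq_eq_norm_toLp_sq (memLp_two_smul_const hφ y)
    rw [← ofReal_integral_eq_lintegral_ofReal ((memLp_two_iff_integrable_sq_norm
      (memLp_two_smul_const hφ y).1).1 (memLp_two_smul_const hφ y))
      (Eventually.of_forall fun _ => by positivity)] at h
    have e : ∀ t, ‖φ t • y‖ ^ 2 = φ t * φ t * ‖y‖ ^ 2 := fun t => by
      rw [norm_smul, mul_pow, Real.norm_eq_abs, sq_abs, sq (φ t)]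
    simp only [e, integral_mul_const, h1, one_mul] at h
    rw [ENNReal.ofReal_eq_ofReal_iff (by positivity) (by positivity)] at h
    exact ((sq_eq_sq₀ (by positivity) (by positivity)).1 h).symm

theorem inner_tensorIsometry [CompleteSpace Y] {φ : α → ℝ} (hφ : MemLp φ 2 μ)
    (h1 : ∫ t, φ t * φ t ∂μ = 1) (y : Y) {f : α → Y} (hf : MemLp f 2 μ) :
    inner ℂ (tensorIsometry hφ h1 y) (hf.toLp f) = inner ℂ y (∫ t, φ t • f t ∂μ) := by
  rw [L2.inner_def, ← integral_inner (integrable_smul_of_memLp_two hφ hf)]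
  refine integral_congr_ae ?_
  filter_upwards [hf.coeFn_toLp, (memLp_two_smul_const hφ y).coeFn_toLp] with t h2 h3
  have h4 : (tensorIsometry hφ h1 y : Lp Y 2 μ) t = φ t • y := h3
  rw [h2, h4, ← Complex.coe_smul, ← Complex.coe_smul, inner_smul_left, inner_smul_right,
    Complex.conj_ofReal]

variable [CompleteSpace Y] {φ : ℕ → α → ℝ}

theorem orthogonalFamily_tensorIsometry (hφ : ∀ n, MemLp (φ n) 2 μ)
    (h1 : ∀ n, ∫ t, φ n t * φ n t ∂μ = 1) (h0 : ∀ n m, n ≠ m → ∫ t, φ n t * φ m t ∂μ = 0) :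
    OrthogonalFamily ℂ (fun _ : ℕ => Y) fun n => tensorIsometry (hφ n) (h1 n) := by
  intro n m hnm y z
  refine (inner_tensorIsometry (hφ n) (h1 n) y (memLp_two_smul_const (hφ m) z)).trans ?_
  simp only [smul_smul]
  rw [integral_smul_const, h0 n m hnm, zero_smul, inner_zero_right]

/-- Bessel's inequality for vector-valued coefficients. -/
theorem tsum_norm_sq_integral_smul_le (hφ : ∀ n, MemLp (φ n) 2 μ)
    (h1 : ∀ n, ∫ t, φ n t * φ n t ∂μ = 1) (h0 : ∀ n m, n ≠ m → ∫ t, φ n t * φ m t ∂μ = 0)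
    {f : α → Y} (hf : MemLp f 2 μ) :
    ∑' n, ENNReal.ofReal (‖∫ t, φ n t • f t ∂μ‖ ^ 2) ≤
      ∫⁻ t, ENNReal.ofReal (‖f t‖ ^ 2) ∂μ := by
  rw [lintegral_norm_sq_eq_norm_toLp_sq hf]
  refine ENNReal.tsum_le_of_sum_range_le fun N => ?_
  rw [← ENNReal.ofReal_sum_of_nonneg fun _ _ => by positivity]
  refine ENNReal.ofReal_le_ofReal ?_
  set c : ℕ → Y := fun n => ∫ t, φ n t • f t ∂μ with hc
  have hV := orthogonalFamily_tensorIsometry (Y := Y) hφ h1 h0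
  set p := ∑ n ∈ Finset.range N, tensorIsometry (hφ n) (h1 n) (c n) with hp
  have hn : ‖p‖ ^ 2 = ∑ n ∈ Finset.range N, ‖c n‖ ^ 2 := hV.norm_sum c _
  have hi : inner ℂ p (hf.toLp f) = ((‖p‖ ^ 2 : ℝ) : ℂ) := by
    rw [hn, hp, sum_inner]
    push_cast
    refine Finset.sum_congr rfl fun n _ => ?_
    rw [inner_tensorIsometry]
    exact inner_self_eq_norm_sq_to_K (𝕜 := ℂ) (c n)
  have hle := norm_inner_le_norm (𝕜 := ℂ) p (hf.toLp f)
  rw [hi, Complex.norm_real, Real.norm_of_nonneg (by positivity)] at hle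
  have hle' : ‖p‖ ≤ ‖hf.toLp f‖ := by
    rcases (norm_nonneg p).eq_or_lt with h | h
    · rw [← h]; positivity
    · rw [sq] at hle; exact le_of_mul_le_mul_left hle h
  change ∑ n ∈ Finset.range N, ‖c n‖ ^ 2 ≤ _
  rw [← hn]
  gcongr

/-- The Riesz-Fischer theorem for vector-valued coefficients. -/
theorem exists_memLp_integral_smul_eq (hφ : ∀ n, MemLp (φ n) 2 μ)
    (h1 : ∀ n, ∫ t, φ n t * φ n t ∂μ = 1) (h0 : ∀ n m, n ≠ m → ∫ t, φ n t * φ m t ∂μ = 0)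
    {c : ℕ → Y} (hc : Summable fun n => ‖c n‖ ^ 2) :
    ∃ g : α → Y, MemLp g 2 μ ∧ (∀ n, ∫ t, φ n t • g t ∂μ = c n) ∧
      ∫⁻ t, ENNReal.ofReal (‖g t‖ ^ 2) ∂μ ≤ ENNReal.ofReal (∑' n, ‖c n‖ ^ 2) := by
  have hV := orthogonalFamily_tensorIsometry (Y := Y) hφ h1 h0
  have hs := ((hV.summable_iff_norm_sq_summable c).2 hc).hasSum
  set G := ∑' n, tensorIsometry (hφ n) (h1 n) (c n) with hG
  have hGm := Lp.memLp G
  have hGt : hGm.toLp G = G := Lp.toLp_coeFn G hGm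
  refine ⟨G, hGm, fun n => ?_, ?_⟩
  · refine ext_inner_left ℂ fun y => ?_
    rw [← inner_tensorIsometry (hφ n) (h1 n) y hGm, hGt]
    refine HasSum.unique (hs.mapL (innerSL ℂ (tensorIsometry (hφ n) (h1 n) y))) ?_
    have h := hasSum_single (f := fun m => inner ℂ (tensorIsometry (hφ n) (h1 n) y)
      (tensorIsometry (hφ m) (h1 m) (c m))) n fun m hm => hV hm.symm y (c m)
    rwa [LinearIsometry.inner_map_map] at h
  · rw [lintegral_norm_sq_eq_norm_toLp_sq hGm, hGt]
    refine ENNReal.ofReal_le_ofReal ?_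
    refine le_of_tendsto (hs.tendsto_sum_nat.norm.pow 2) (Eventually.of_forall fun N => ?_)
    rw [hV.norm_sum c]
    exact hc.sum_le_tsum _ fun _ _ => by positivity

end OrthonormalSequence

/-! ### Laguerre functions -/

/-- The normalised Laguerre function, proportional to `t^((s-1)/2) e^(-t) L_n^(s-1)(2t)`; only its
values at `t > 0` matter. -/
noncomputable def laguerreFun (s : ℝ) (n : ℕ) (t : ℝ) : ℝ :=
  (√(laguerreNormSq s n))⁻¹ * (t ^ ((s - 1) / 2) * Real.exp (-t) * laguerre s n t)

theorem rpow_half_mul_self {s t : ℝ} (ht : 0 < t) :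
    t ^ ((s - 1) / 2) * t ^ ((s - 1) / 2) = t ^ (s - 1) := by
  rw [← Real.rpow_add ht]; ring_nf

theorem laguerreFun_mul {s t : ℝ} (ht : 0 < t) (n m : ℕ) :
    laguerreFun s n t * laguerreFun s m t =
      ((√(laguerreNormSq s n))⁻¹ * (√(laguerreNormSq s m))⁻¹) *
        (t ^ (s - 1) * Real.exp (-(2 * t)) * (laguerre s n t * laguerre s m t)) := by
  rw [← rpow_half_mul_self ht, show -(2 * t) = -t + -t by ring, Real.exp_add]
  unfold laguerreFun
  ring

theorem aestronglyMeasurable_rpow (a : ℝ) :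
    AEStronglyMeasurable (fun t : ℝ => t ^ a) (volume.restrict (Ioi 0)) :=
  (measurable_id.pow_const a).aestronglyMeasurable

theorem aestronglyMeasurable_laguerreFun (s : ℝ) (n : ℕ) :
    AEStronglyMeasurable (laguerreFun s n) (volume.restrict (Ioi 0)) :=
  (((aestronglyMeasurable_rpow _).mul (Continuous.aestronglyMeasurable (by fun_prop))).mul
    (continuous_laguerre s n).aestronglyMeasurable).const_mul _

theorem memLp_laguerreFun {s : ℝ} (hs : 0 < s) (n : ℕ) :
    MemLp (laguerreFun s n) 2 (volume.restrict (Ioi 0)) := by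
  rw [memLp_two_iff_integrable_sq (aestronglyMeasurable_laguerreFun s n)]
  refine IntegrableOn.congr_fun ((integrableOn_laguerre_mul_laguerre hs two_pos n n).const_mul
    ((√(laguerreNormSq s n))⁻¹ * (√(laguerreNormSq s n))⁻¹)) (fun t ht => ?_) measurableSet_Ioi
  rw [sq, laguerreFun_mul ht]

theorem integral_laguerreFun_mul (s : ℝ) (n m : ℕ) :
    ∫ t in Ioi (0 : ℝ), laguerreFun s n t * laguerreFun s m t =
      ((√(laguerreNormSq s n))⁻¹ * (√(laguerreNormSq s m))⁻¹) *
        ∫ t in Ioi (0 : ℝ),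
          t ^ (s - 1) * Real.exp (-(2 * t)) * (laguerre s n t * laguerre s m t) := by
  rw [← integral_const_mul]
  exact setIntegral_congr_fun measurableSet_Ioi fun t ht => laguerreFun_mul ht n m

theorem integral_laguerreFun_mul_self {s : ℝ} (hs : 0 < s) (n : ℕ) :
    ∫ t in Ioi (0 : ℝ), laguerreFun s n t * laguerreFun s n t = 1 := by
  have h := laguerreNormSq_pos hs n
  rw [integral_laguerreFun_mul, integral_laguerre_mul_self hs, ← mul_inv, Real.mul_self_sqrt h.le,
    inv_mul_cancel₀ h.ne']

theorem integral_laguerreFun_mul_of_ne {s : ℝ} (hs : 0 < s) (n m : ℕ) (h : n ≠ m) :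
    ∫ t in Ioi (0 : ℝ), laguerreFun s n t * laguerreFun s m t = 0 := by
  rw [integral_laguerreFun_mul, integral_laguerre_mul_laguerre_of_ne hs h, mul_zero]

section Expansion

variable {Y : Type*} [NormedAddCommGroup Y] [InnerProductSpace ℂ Y]

/-- If all Laguerre moments vanish then so do all moments, the `n`-th Laguerre polynomial being of
exact degree `n`. -/
theorem forall_moment_eq_zero_of_laguerre {s : ℝ} (hs : 0 < s) {u : ℝ → Y}
    (hu : ∀ k : ℕ, IntegrableOn (fun t => t ^ k • u t) (Ioi 0))
    (h : ∀ n, ∫ t in Ioi (0 : ℝ), laguerre s n t • u t = 0) (k : ℕ) :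
    ∫ t in Ioi (0 : ℝ), t ^ k • u t = 0 := by
  induction k using Nat.strong_induction_on with
  | _ k ih =>
    have hk := h k
    have e : ∀ t, laguerre s k t • u t = ∑ j ∈ Finset.range (k + 1),
        ((-1) ^ j * (k.choose j) * 2 ^ j / Real.Gamma (s + j)) • (t ^ j • u t) := by
      intro t
      simp only [laguerre, Finset.sum_smul, smul_smul]
      refine Finset.sum_congr rfl fun j _ => ?_
      rw [mul_pow]; congr 1; ring
    simp only [e] at hk
    have hi : ∀ j ∈ Finset.range (k + 1), IntegrableOn (fun t =>
        ((-1) ^ j * (k.choose j) * 2 ^ j / Real.Gamma (s + j)) • (t ^ j • u t)) (Ioi 0) :=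
      fun j _ => (hu j).smul _
    rw [integral_finsetSum _ hi, Finset.sum_range_succ, Finset.sum_eq_zero,
      zero_add, integral_smul] at hk
    · refine (smul_eq_zero.1 hk).resolve_left ?_
      have := Real.Gamma_pos_of_pos (s := s + k) (by positivity)
      rw [Nat.choose_self]
      simp [this.ne']
    · intro j hj
      rw [integral_smul, ih j (Finset.mem_range.1 hj), smul_zero]

variable [CompleteSpace Y]

theorem memLp_rpow_half_mul_exp {s r : ℝ} (hs : 0 < s) (hr : 0 < r) :
    MemLp (fun t : ℝ => t ^ ((s - 1) / 2) * Real.exp (-(r * t))) 2 (volume.restrict (Ioi 0)) := by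
  have hm : AEStronglyMeasurable (fun t : ℝ => t ^ ((s - 1) / 2) * Real.exp (-(r * t)))
      (volume.restrict (Ioi 0)) :=
    (aestronglyMeasurable_rpow _).mul (Continuous.aestronglyMeasurable (by fun_prop))
  rw [memLp_two_iff_integrable_sq hm]
  have h := integrableOn_rpow_mul_exp_mul_pow hs (r := 2 * r) (by positivity) 0
  refine IntegrableOn.congr_fun h (fun t ht => ?_) measurableSet_Ioi
  rw [← rpow_half_mul_self ht, show -(2 * r * t) = -(r * t) + -(r * t) by ring, Real.exp_add]
  ring

/-- A function `f`, bounded but not assumed square integrable against `t^(s-1)`, is square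
integrable as soon as its Laguerre coefficients are square summable: the difference between `f` and
its Laguerre expansion has zero moments. -/
theorem lintegral_rpow_mul_norm_sq_le_tsum {s : ℝ} (hs : 0 < s) {f : ℝ → Y}
    (hfm : AEStronglyMeasurable f (volume.restrict (Ioi 0))) {B : ℝ} (hB : ∀ t, ‖f t‖ ≤ B)
    (hc : Summable fun n =>
      ‖∫ t in Ioi (0 : ℝ), laguerreFun s n t • (t ^ ((s - 1) / 2) • f t)‖ ^ 2) :
    ∫⁻ t in Ioi (0 : ℝ), ENNReal.ofReal (t ^ (s - 1) * ‖f t‖ ^ 2) ≤ ENNReal.ofReal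
      (∑' n, ‖∫ t in Ioi (0 : ℝ), laguerreFun s n t • (t ^ ((s - 1) / 2) • f t)‖ ^ 2) := by
  obtain ⟨g, hg, hgc, hgn⟩ := exists_memLp_integral_smul_eq (memLp_laguerreFun hs)
    (integral_laguerreFun_mul_self hs) (integral_laguerreFun_mul_of_ne hs) hc
  refine le_trans (le_of_eq ?_) hgn
  -- The weight `w` makes the moments of the bounded part `v` and of the `L²` part `g` finite; the
  -- two have the same Laguerre coefficients, so `u = w (v - g)` has zero moments.
  set v : ℝ → Y := fun t => t ^ ((s - 1) / 2) • f t with hv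
  set w : ℝ → ℝ := fun t => t ^ ((s - 1) / 2) * Real.exp (-t) with hw
  have hwm : AEStronglyMeasurable w (volume.restrict (Ioi 0)) :=
    (aestronglyMeasurable_rpow _).mul (Continuous.aestronglyMeasurable (by fun_prop))
  have hvm : AEStronglyMeasurable v (volume.restrict (Ioi 0)) :=
    (aestronglyMeasurable_rpow _).smul hfm
  have hI1 : ∀ r < (1 : ℝ), IntegrableOn (fun t => Real.exp (r * t) • (w t • v t)) (Ioi 0) := by
    intro r hr
    have h := (integrableOn_rpow_mul_exp_mul_pow hs (r := 1 - r) (by linarith) 0).mul_const B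
    have hexp : AEStronglyMeasurable (fun t : ℝ => Real.exp (r * t)) (volume.restrict (Ioi 0)) :=
      Continuous.aestronglyMeasurable (by fun_prop)
    refine Integrable.mono' h (hexp.smul (hwm.smul hvm)) ?_
    filter_upwards [ae_restrict_mem measurableSet_Ioi] with t ht
    have ht' : (0 : ℝ) < t := ht
    rw [← rpow_half_mul_self ht', show -((1 - r) * t) = r * t + -t by ring, Real.exp_add, hw, hv]
    simp only [norm_smul, norm_mul, Real.norm_eq_abs, Real.abs_exp, pow_zero, mul_one]
    rw [abs_of_nonneg (Real.rpow_nonneg ht'.le _)]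
    have := hB t
    calc _ = (t ^ ((s - 1) / 2) * t ^ ((s - 1) / 2) *
          (Real.exp (r * t) * Real.exp (-t))) * ‖f t‖ := by ring
      _ ≤ _ := by gcongr
  have hI2 : ∀ r < (1 : ℝ), IntegrableOn (fun t => Real.exp (r * t) • (w t • g t)) (Ioi 0) := by
    intro r hr
    refine (integrable_smul_of_memLp_two (memLp_rpow_half_mul_exp hs (r := 1 - r)
      (by linarith)) hg).congr (Eventually.of_forall fun t => ?_)
    simp only [hw, smul_smul]
    rw [show -((1 - r) * t) = r * t + -t by ring, Real.exp_add]
    congr 1; ring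
  set u : ℝ → Y := fun t => w t • v t - w t • g t with hu
  have hum : AEStronglyMeasurable u (volume.restrict (Ioi 0)) :=
    (hwm.smul hvm).sub (hwm.smul hg.1)
  have hui : ∀ r < (1 : ℝ), IntegrableOn (fun t => Real.exp (r * t) • u t) (Ioi 0) := by
    intro r hr
    simp only [hu, smul_sub]
    exact (hI1 r hr).sub (hI2 r hr)
  have hpow : ∀ {x : ℝ → Y}, AEStronglyMeasurable x (volume.restrict (Ioi 0)) →
      (∀ r < (1 : ℝ), IntegrableOn (fun t => Real.exp (r * t) • x t) (Ioi 0)) → ∀ k : ℕ,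
      IntegrableOn (fun t => t ^ k • x t) (Ioi 0) := by
    intro x hx hxi k
    refine (integrableOn_laplaceIntegrand hx hxi k (z := 0) (by simp)).congr
      (Eventually.of_forall fun t => ?_)
    simp only [zero_mul, Complex.exp_zero, mul_one]
    rw [← Complex.coe_smul, Complex.ofReal_pow]
  have hL : ∀ n, ∫ t in Ioi (0 : ℝ), laguerre s n t • u t = 0 := by
    intro n
    have hi : ∀ {x : ℝ → Y}, (∀ k : ℕ, IntegrableOn (fun t => t ^ k • x t) (Ioi 0)) →
        IntegrableOn (fun t => laguerre s n t • x t) (Ioi 0) := by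
      intro x hx
      simp only [laguerre, Finset.sum_smul]
      refine integrable_finsetSum _ fun j _ => ?_
      refine ((hx j).smul ((-1) ^ j * (n.choose j) * 2 ^ j / Real.Gamma (s + j))).congr
        (Eventually.of_forall fun t => ?_)
      simp only [Pi.smul_apply, smul_smul, mul_pow]
      congr 1; ring
    have hpos := Real.sqrt_pos.2 (laguerreNormSq_pos hs n)
    have e : ∀ (x : ℝ → Y), ∫ t in Ioi (0 : ℝ), laguerre s n t • (w t • x t) =
        √(laguerreNormSq s n) • ∫ t in Ioi (0 : ℝ), laguerreFun s n t • x t := by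
      intro x
      rw [← integral_smul]
      refine integral_congr_ae (Eventually.of_forall fun t => ?_)
      simp only [smul_smul, hw, laguerreFun]
      congr 1
      field_simp
    simp only [hu, smul_sub]
    have h1 : IntegrableOn (fun t => laguerre s n t • w t • v t) (Ioi 0) :=
      hi (hpow (hwm.smul hvm) hI1)
    have h2 : IntegrableOn (fun t => laguerre s n t • w t • g t) (Ioi 0) :=
      hi (hpow (hwm.smul hg.1) hI2)
    rw [integral_sub h1 h2, e, e, hgc n, sub_self]
  have hae := ae_eq_zero_of_forall_moment_eq_zero hum one_pos hui
    (forall_moment_eq_zero_of_laguerre hs (hpow hum hui) hL)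
  refine lintegral_congr_ae ?_
  filter_upwards [hae, ae_restrict_mem measurableSet_Ioi] with t h0 ht
  have ht' : (0 : ℝ) < t := ht
  have hwt : w t ≠ 0 := (mul_pos (Real.rpow_pos_of_pos ht' _) (Real.exp_pos _)).ne'
  have hvg : v t = g t := by
    simp only [hu, ← smul_sub] at h0
    exact sub_eq_zero.1 ((smul_eq_zero.1 h0).resolve_left hwt)
  rw [← hvg, hv, norm_smul, mul_pow, sq ‖t ^ ((s - 1) / 2)‖,
    Real.norm_of_nonneg (Real.rpow_nonneg ht'.le _), rpow_half_mul_self ht']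

/-- Bessel's inequality for Laguerre coefficients. -/
theorem tsum_le_lintegral_rpow_mul_norm_sq {s : ℝ} (hs : 0 < s) {f : ℝ → Y}
    (hfm : AEStronglyMeasurable f (volume.restrict (Ioi 0)))
    (hf : ∫⁻ t in Ioi (0 : ℝ), ENNReal.ofReal (t ^ (s - 1) * ‖f t‖ ^ 2) ≠ ∞) :
    ∑' n, ENNReal.ofReal
        (‖∫ t in Ioi (0 : ℝ), laguerreFun s n t • (t ^ ((s - 1) / 2) • f t)‖ ^ 2) ≤
      ∫⁻ t in Ioi (0 : ℝ), ENNReal.ofReal (t ^ (s - 1) * ‖f t‖ ^ 2) := by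
  have e : ∫⁻ t in Ioi (0 : ℝ), ENNReal.ofReal (t ^ (s - 1) * ‖f t‖ ^ 2) =
      ∫⁻ t in Ioi (0 : ℝ), ENNReal.ofReal (‖t ^ ((s - 1) / 2) • f t‖ ^ 2) := by
    refine setLIntegral_congr_fun measurableSet_Ioi fun t ht => ?_
    have ht' : (0 : ℝ) < t := ht
    rw [norm_smul, mul_pow, sq ‖t ^ ((s - 1) / 2)‖,
      Real.norm_of_nonneg (Real.rpow_nonneg ht'.le _), rpow_half_mul_self ht']
  have hm := (aestronglyMeasurable_rpow ((s - 1) / 2)).smul hfm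
  rw [e] at hf ⊢
  refine tsum_norm_sq_integral_smul_le (memLp_laguerreFun hs) (integral_laguerreFun_mul_self hs)
    (integral_laguerreFun_mul_of_ne hs) ((memLp_two_iff_integrable_sq_norm hm).2 ⟨?_, ?_⟩)
  · exact (hm.norm.pow 2)
  · rw [hasFiniteIntegral_iff_ofReal (Eventually.of_forall fun _ => by positivity)]
    exact lt_top_iff_ne_top.2 hf

end Expansion

namespace ContractionSemigroup

/-! ### The resolvent and the cogenerator -/

section Resolvent

variable {X : Type*} [NormedAddCommGroup X] [NormedSpace ℂ X] (S : ContractionSemigroup X)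

theorem incl_injective : Function.Injective S.incl := Subtype.val_injective

theorem incl_onDomain (t : ℝ≥0) (x : S.Domain) : S.incl (S.onDomain t x) = S t (S.incl x) := rfl

theorem one_re_pos : 0 < (1 : ℂ).re := by simp

theorem negPow_congr {l : ℂ} (hl : 0 < l.re) {s s' : ℝ} (h : s = s') (hs : 0 < s) (hs' : 0 < s') :
    S.negPow hl hs = S.negPow hl hs' := by
  subst h; rfl

theorem negPow_one_eq_integral {s : ℝ} (hs : 0 < s) (x : X) :
    S.negPow one_re_pos hs x = (Real.Gamma s)⁻¹ •
      ∫ t in Ioi (0 : ℝ), (t ^ (s - 1) * Real.exp (-t)) • S t.toNNReal x := by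
  rw [negPow_apply]
  congr 1
  refine integral_congr_ae (Eventually.of_forall fun t => ?_)
  simp only [powIntegrand]
  rw [← Complex.coe_smul (_ * _)]
  simp

theorem integrableOn_rpow_mul_exp_smul {s : ℝ} (hs : 0 < s) (x : X) :
    IntegrableOn (fun t : ℝ => (t ^ (s - 1) * Real.exp (-t)) • S t.toNNReal x) (Ioi 0) := by
  refine (S.integrableOn_powIntegrand one_re_pos hs x).congr (Eventually.of_forall fun t => ?_)
  simp only [powIntegrand]
  rw [← Complex.coe_smul (_ * _)]
  simp

theorem rpow_mul_exp_mul_laguerre_smul {s t : ℝ} (ht : 0 < t) (n : ℕ) (y : X) :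
    (t ^ (s - 1) * Real.exp (-t) * laguerre s n t) • y = ∑ j ∈ Finset.range (n + 1),
      ((-1) ^ j * (n.choose j) * 2 ^ j / Real.Gamma (s + j)) •
        ((t ^ (s + j - 1) * Real.exp (-t)) • y) := by
  simp only [laguerre, Finset.mul_sum, Finset.sum_smul, smul_smul]
  refine Finset.sum_congr rfl fun j _ => ?_
  rw [show s + j - 1 = s - 1 + j by ring, Real.rpow_add ht, Real.rpow_natCast, mul_pow]
  congr 1
  ring

theorem integrableOn_laguerre_smul {s : ℝ} (hs : 0 < s) (n : ℕ) (x : X) :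
    IntegrableOn (fun t : ℝ => (t ^ (s - 1) * Real.exp (-t) * laguerre s n t) • S t.toNNReal x)
      (Ioi 0) := by
  refine IntegrableOn.congr_fun (integrable_finsetSum (Finset.range (n + 1)) fun j _ =>
    (S.integrableOn_rpow_mul_exp_smul (s := s + j) (by positivity) x).smul
      ((-1) ^ j * (n.choose j) * 2 ^ j / Real.Gamma (s + j))) (fun t ht => ?_) measurableSet_Ioi
  simp only [Pi.smul_apply]
  rw [rpow_mul_exp_mul_laguerre_smul ht]

variable [CompleteSpace X]

theorem negPow_add_one {l : ℂ} (hl : 0 < l.re) {s : ℝ} (hs : 0 < s) (hs' : 0 < s + 1) (x : X) :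
    S.negPow hl hs' x = S.negPow hl one_pos (S.negPow hl hs x) := by
  rw [S.negPow_eq hl hs' (by simpa using hs), S.negPow_congr hl (by ring : s + 1 - 1 = s) _ hs]

theorem pow_negPow_one_apply {l : ℂ} (hl : 0 < l.re) {s : ℝ} (hs : 0 < s) (j : ℕ)
    (hs' : 0 < s + j) (x : X) :
    (S.negPow hl one_pos ^ j) (S.negPow hl hs x) = S.negPow hl hs' x := by
  induction j with
  | zero => simp [S.negPow_congr hl (by simp : s = s + (0 : ℕ)) hs hs']
  | succ j ih =>
    have h : 0 < s + j := by positivity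
    rw [pow_succ', mul_apply_eq_comp, ih h,
      ← S.negPow_add_one hl h (by positivity),
      S.negPow_congr hl (by push_cast; ring : s + j + 1 = s + (j + 1 : ℕ)) _ hs']

theorem negPowDomain_eq_of_incl {l : ℂ} (hl : 0 < l.re) {s : ℝ} (hs : 1 ≤ s) {x : X}
    {u : S.Domain} (h : S.incl u = S.negPow hl (one_pos.trans_le hs) x) :
    S.negPowDomain hl hs x = u :=
  S.incl_injective h.symm

theorem sub_gen_negPowDomain_one {l : ℂ} (hl : 0 < l.re) (x : X) :
    l • S.incl (S.negPowDomain hl le_rfl x) - S.gen (S.negPowDomain hl le_rfl x) = x := by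
  obtain ⟨u, hu, hu'⟩ := S.resolvent_right hl x
  rwa [S.negPowDomain_eq_of_incl hl le_rfl hu]

theorem exists_negPowDomain_one_eq (x : S.Domain) :
    ∃ z, S.negPowDomain one_re_pos le_rfl z = x :=
  ⟨_, S.negPowDomain_eq_of_incl _ _ (S.resolvent_left one_re_pos x).symm⟩

theorem cogenerator_eq :
    S.cogenerator = (2 : ℂ) • S.negPow one_re_pos one_pos - ContinuousLinearMap.id ℂ X := by
  ext x
  have h := S.sub_gen_negPowDomain_one one_re_pos x
  rw [one_smul, sub_eq_iff_eq_add] at h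
  have h2 : S.incl (S.negPowDomain one_re_pos le_rfl x) = S.negPow one_re_pos one_pos x := rfl
  have h3 : S.cogenerator x = S.incl (S.negPowDomain one_re_pos le_rfl x) +
    S.gen (S.negPowDomain one_re_pos le_rfl x) := rfl
  rw [h2] at h h3
  have h4 : S.gen (S.negPowDomain one_re_pos le_rfl x) = S.negPow one_re_pos one_pos x - x := by
    rw [eq_sub_iff_add_eq']; exact h.symm
  rw [h3, h4]
  simp [two_smul]
  abel

theorem negPow_apply_semigroup {l : ℂ} (hl : 0 < l.re) {s : ℝ} (hs : 0 < s) (t : ℝ≥0) (x : X) :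
    S.negPow hl hs (S t x) = S t (S.negPow hl hs x) :=
  (S.negPow_comm hl hs (S t) (fun _ _ => S.comm _ _ _) x).symm

theorem cogenerator_apply_semigroup (t : ℝ≥0) (x : X) :
    S.cogenerator (S t x) = S t (S.cogenerator x) := by
  simp [cogenerator_eq, negPow_apply_semigroup]

theorem cogenerator_pow_apply_semigroup (n : ℕ) (t : ℝ≥0) (x : X) :
    (S.cogenerator ^ n) (S t x) = S t ((S.cogenerator ^ n) x) := by
  induction n with
  | zero => rfl
  | succ n ih =>
    rw [pow_succ', mul_apply_eq_comp, mul_apply_eq_comp, ih,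
      cogenerator_apply_semigroup]

theorem cogenerator_pow_negPow {l : ℂ} (hl : 0 < l.re) {s : ℝ} (hs : 0 < s) (n : ℕ) (x : X) :
    (S.cogenerator ^ n) (S.negPow hl hs x) = S.negPow hl hs ((S.cogenerator ^ n) x) :=
  S.negPow_comm hl hs _ (fun t z => S.cogenerator_pow_apply_semigroup n t z) x

theorem negPow_negPow_comm {l l' : ℂ} (hl : 0 < l.re) (hl' : 0 < l'.re) {s s' : ℝ} (hs : 0 < s)
    (hs' : 0 < s') (x : X) :
    S.negPow hl hs (S.negPow hl' hs' x) = S.negPow hl' hs' (S.negPow hl hs x) :=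
  S.negPow_comm hl' hs' _ (fun t z => S.negPow_apply_semigroup hl hs t z) x

/-- By the binomial theorem for `T = 2 (I - A)⁻¹ - I`, the vector `T ^ n (I - A) ^ (-s) x` is a
Laguerre coefficient of the orbit of `x`. -/
theorem cogenerator_pow_negPow_eq_integral {s : ℝ} (hs : 0 < s) (n : ℕ) (x : X) :
    (S.cogenerator ^ n) (S.negPow one_re_pos hs x) = (-1 : ℝ) ^ n •
      ∫ t in Ioi (0 : ℝ), (t ^ (s - 1) * Real.exp (-t) * laguerre s n t) • S t.toNNReal x := by
  have hc : S.cogenerator = (2 : ℂ) • S.negPow one_re_pos one_pos + (-1 : ℂ) • 1 := by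
    rw [cogenerator_eq, neg_one_smul, sub_eq_add_neg]; rfl
  have hcomm : Commute ((2 : ℂ) • S.negPow one_re_pos one_pos) ((-1 : ℂ) • (1 : X →L[ℂ] X)) :=
    (Commute.one_right _).smul_right _
  have hi : ∀ j ∈ Finset.range (n + 1), IntegrableOn (fun t : ℝ =>
      ((-1) ^ j * (n.choose j) * 2 ^ j / Real.Gamma (s + j)) •
        ((t ^ (s + j - 1) * Real.exp (-t)) • S t.toNNReal x)) (Ioi 0) := fun j _ =>
    (S.integrableOn_rpow_mul_exp_smul (s := s + j) (by positivity) x).smul _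
  rw [setIntegral_congr_fun measurableSet_Ioi fun t ht => rpow_mul_exp_mul_laguerre_smul ht n _,
    integral_finsetSum _ hi, hc, hcomm.add_pow, sum_apply, Finset.smul_sum]
  refine Finset.sum_congr rfl fun j hj => ?_
  have hs' : 0 < s + j := by positivity
  obtain ⟨m, hm⟩ := Nat.exists_eq_add_of_le (Nat.lt_succ_iff.1 (Finset.mem_range.1 hj))
  have hz : (((2 : ℂ) • S.negPow one_re_pos one_pos) ^ j * ((-1 : ℂ) • (1 : X →L[ℂ] X)) ^ (n - j) *
      (n.choose j : X →L[ℂ] X)) (S.negPow one_re_pos hs x) =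
      ((n.choose j : ℝ) * (-1) ^ (n - j) * 2 ^ j) • S.negPow one_re_pos hs' x := by
    rw [smul_pow, smul_pow, one_pow, ← Nat.smul_one_eq_cast,
      ← S.pow_negPow_one_apply one_re_pos hs j hs', ← Complex.coe_smul]
    simp
    rw [← Nat.cast_smul_eq_nsmul ℂ, smul_smul, smul_smul]
    congr 1
    ring
  rw [hz, integral_smul, S.negPow_one_eq_integral hs', smul_smul, smul_smul]
  congr 1
  rw [hm, Nat.add_sub_cancel_left, pow_add]
  have h1 : ((-1 : ℝ) ^ j) * (-1) ^ j = 1 := by rw [← mul_pow]; simp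
  linear_combination (-(((j + m).choose j : ℝ) * (-1) ^ m * 2 ^ j * (Real.Gamma (s + j))⁻¹)) * h1

end Resolvent

/-! ### Dissipativity -/

section Dissipative

variable {H : Type*} [NormedAddCommGroup H] [InnerProductSpace ℂ H] (S : ContractionSemigroup H)

/-- The generator of a contraction semigroup on a Hilbert space is dissipative. -/
theorem re_inner_gen_nonpos (x : S.Domain) : (inner ℂ (S.incl x) (S.gen x)).re ≤ 0 := by
  have h : Tendsto (fun h : ℝ => (inner ℂ (S.incl x)
      (h⁻¹ • (S h.toNNReal (S.incl x) - S.incl x))).re) (𝓝[>] 0)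
      (𝓝 (inner ℂ (S.incl x) (S.gen x)).re) :=
    (Complex.continuous_re.tendsto _).comp (Tendsto.inner tendsto_const_nhds (S.hasGenerator' x))
  refine le_of_tendsto h ?_
  filter_upwards [self_mem_nhdsWithin] with t ht
  have ht' : (0 : ℝ) < t := ht
  rw [← Complex.coe_smul, inner_smul_right, Complex.re_ofReal_mul, inner_sub_right, Complex.sub_re]
  refine mul_nonpos_of_nonneg_of_nonpos (by positivity) ?_
  have h1 := re_inner_le_norm (𝕜 := ℂ) (S.incl x) (S t.toNNReal (S.incl x))
  have h2 := S.norm_apply_le t.toNNReal (S.incl x)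
  have h3 : (inner ℂ (S.incl x) (S.incl x)).re = ‖S.incl x‖ ^ 2 :=
    inner_self_eq_norm_sq (𝕜 := ℂ) (S.incl x)
  have h4 : (inner ℂ (S.incl x) (S t.toNNReal (S.incl x))).re ≤
    ‖S.incl x‖ * ‖S t.toNNReal (S.incl x)‖ := h1
  nlinarith [norm_nonneg (S.incl x)]

variable [CompleteSpace H]

theorem norm_cogenerator_le_one : ‖S.cogenerator‖ ≤ 1 := by
  refine ContinuousLinearMap.opNorm_le_bound _ zero_le_one fun x => ?_
  rw [one_mul]
  set u := S.negPowDomain one_re_pos le_rfl x with hu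
  have h1 : S.cogenerator x = S.incl u + S.gen u := rfl
  have h2 : S.incl u - S.gen u = x := by
    simpa only [one_smul] using S.sub_gen_negPowDomain_one one_re_pos x
  have h3 := S.re_inner_gen_nonpos u
  have h4 := norm_add_sq (𝕜 := ℂ) (S.incl u) (S.gen u)
  have h5 := norm_sub_sq (𝕜 := ℂ) (S.incl u) (S.gen u)
  rw [h2] at h5
  rw [← h1] at h4
  have h6 : RCLike.re (inner ℂ (S.incl u) (S.gen u)) ≤ 0 := h3
  exact (sq_le_sq₀ (norm_nonneg _) (norm_nonneg _)).1 (by linarith)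

/-- The domain `D(A)`, the range of `(I - A)⁻¹`, is dense: for `y` orthogonal to it,
`v = (I - A)⁻¹ y` satisfies `‖v‖² = Re ⟨v, A v⟩ ≤ 0`. -/
theorem denseRange_negPow_one : DenseRange (S.negPow one_re_pos one_pos) := by
  have h : ((S.negPow one_re_pos one_pos).range).topologicalClosure = ⊤ := by
    rw [Submodule.topologicalClosure_eq_top_iff, Submodule.eq_bot_iff]
    intro y hy
    set v := S.negPowDomain one_re_pos le_rfl y with hv
    have h1 : S.incl v - S.gen v = y := by
      simpa only [one_smul] using S.sub_gen_negPowDomain_one one_re_pos y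
    have h2 : inner ℂ (S.incl v) y = 0 := hy _ ⟨y, rfl⟩
    have h3 := S.re_inner_gen_nonpos v
    rw [← h1, inner_sub_right, sub_eq_zero] at h2
    rw [← h2] at h3
    have h4 : (inner ℂ (S.incl v) (S.incl v)).re = ‖S.incl v‖ ^ 2 :=
      inner_self_eq_norm_sq (𝕜 := ℂ) (S.incl v)
    rw [h4] at h3
    have h5 : S.incl v = 0 := norm_eq_zero.1 (by nlinarith [norm_nonneg (S.incl v)])
    have h6 : v = 0 := S.incl_injective (by rw [h5, map_zero])
    rw [← h1, h6]
    simp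
  have h' := Submodule.dense_iff_topologicalClosure_eq_top.2 h
  exact h'

end Dissipative

/-! ### Admissibility -/

section Admissible

variable {X Y : Type*} [NormedAddCommGroup X] [NormedSpace ℂ X] [CompleteSpace X]
  [NormedAddCommGroup Y] [InnerProductSpace ℂ Y] (S : ContractionSemigroup X)

/-- The output `t ↦ C S(t) x` for the initial state `x = (I - A)⁻¹ z`, in terms of the bounded
operator `C (I - A)⁻¹`. -/
noncomputable def output (C : S.Domain →L[ℂ] Y) (z : X) (t : ℝ) : Y :=
  C (S.negPowDomain one_re_pos le_rfl (S t.toNNReal z))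

theorem apply_onDomain_negPowDomain (C : S.Domain →L[ℂ] Y) (z : X) (t : ℝ) :
    C (S.onDomain t.toNNReal (S.negPowDomain one_re_pos le_rfl z)) = S.output C z t := by
  rw [output]
  congr 1
  refine (S.negPowDomain_eq_of_incl _ _ ?_).symm
  rw [incl_onDomain, incl_negPowDomain, negPow_apply_semigroup]

theorem continuous_output (C : S.Domain →L[ℂ] Y) (z : X) : Continuous (S.output C z) :=
  (C.comp (S.negPowDomain one_re_pos le_rfl)).continuous.comp (S.continuous_orbit z)

theorem norm_output_le (C : S.Domain →L[ℂ] Y) (z : X) (t : ℝ) :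
    ‖S.output C z t‖ ≤ ‖C.comp (S.negPowDomain one_re_pos le_rfl)‖ * ‖z‖ :=
  (C.comp (S.negPowDomain one_re_pos le_rfl)).le_opNorm_of_le (S.norm_apply_le _ _)

variable [CompleteSpace Y]

/-- The sequence `F T ^ n x` consists, up to sign, of the Laguerre coefficients of the output. -/
theorem norm_sq_discreteObservation_cogenerator_pow {β : ℝ} (hβ : 0 ≤ β) (C : S.Domain →L[ℂ] Y)
    (n : ℕ) (z : X) :
    ‖S.discreteObservation hβ C ((S.cogenerator ^ n) (S.negPow one_re_pos one_pos z))‖ ^ 2 =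
      laguerreNormSq (1 + β) n * ‖∫ t in Ioi (0 : ℝ), laguerreFun (1 + β) n t •
        (t ^ ((1 + β - 1) / 2) • S.output C z t)‖ ^ 2 := by
  have hs : 0 < 1 + β := by linarith
  have hν := laguerreNormSq_pos hs n
  set K := C.comp (S.negPowDomain one_re_pos le_rfl) with hK
  have h1 : S.discreteObservation hβ C ((S.cogenerator ^ n) (S.negPow one_re_pos one_pos z)) =
      K ((S.cogenerator ^ n) (S.negPow one_re_pos hs z)) := by
    rw [discreteObservation, hK, ContinuousLinearMap.comp_apply, ContinuousLinearMap.comp_apply]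
    congr 1
    refine S.negPowDomain_eq_of_incl _ _ ?_
    rw [incl_negPowDomain, cogenerator_pow_negPow, cogenerator_pow_negPow,
      S.negPow_negPow_comm one_re_pos one_re_pos]
  have h2 : ∫ t in Ioi (0 : ℝ), (t ^ (1 + β - 1) * Real.exp (-t) * laguerre (1 + β) n t) •
      S.output C z t = √(laguerreNormSq (1 + β) n) • ∫ t in Ioi (0 : ℝ),
        laguerreFun (1 + β) n t • (t ^ ((1 + β - 1) / 2) • S.output C z t) := by
    rw [← integral_smul]
    refine setIntegral_congr_fun measurableSet_Ioi fun t ht => ?_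
    have := Real.sqrt_pos.2 hν
    simp only [smul_smul]
    rw [← rpow_half_mul_self ht, laguerreFun]
    congr 1
    field_simp
  rw [h1, S.cogenerator_pow_negPow_eq_integral hs, K.map_smul_of_tower,
    ← K.integral_comp_comm (S.integrableOn_laguerre_smul hs n z)]
  simp only [K.map_smul_of_tower]
  have h3 : ∀ t : ℝ, K (S t.toNNReal z) = S.output C z t := fun t => rfl
  simp only [h3]
  rw [h2, norm_smul, norm_smul, norm_pow, norm_neg, norm_one, one_pow, one_mul, mul_pow,
    Real.norm_eq_abs, sq_abs, Real.sq_sqrt hν.le]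

theorem isAdmissible_of_discrete {β : ℝ} (hβ : 0 < β) (C : S.Domain →L[ℂ] Y)
    (h : DiscreteObservation.IsAdmissible β (S.discreteObservation hβ.le C) S.cogenerator) :
    S.IsAdmissible β C := by
  obtain ⟨M, hM, h⟩ := h
  obtain ⟨a, b, ha, hb, hab⟩ := exists_rpow_mul_laguerreNormSq_bounds hβ
  have hs : 0 < 1 + β := by linarith
  refine ⟨a⁻¹ * M, by positivity, fun x => ?_⟩
  obtain ⟨z, rfl⟩ := S.exists_negPowDomain_one_eq x
  set c : ℕ → Y := fun n => ∫ t in Ioi (0 : ℝ), laguerreFun (1 + β) n t •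
        (t ^ ((1 + β - 1) / 2) • S.output C z t) with hc
  have hle : ∑' n, ENNReal.ofReal (‖c n‖ ^ 2) ≤
      ENNReal.ofReal (a⁻¹ * M * ‖S.negPow one_re_pos one_pos z‖ ^ 2) := by
    rw [mul_assoc, ENNReal.ofReal_mul (by positivity)]
    refine le_trans ?_ (mul_le_mul_right (h _) _)
    rw [← ENNReal.tsum_mul_left]
    refine ENNReal.tsum_le_tsum fun n => ?_
    rw [← ENNReal.ofReal_mul (by positivity), norm_sq_discreteObservation_cogenerator_pow]
    refine ENNReal.ofReal_le_ofReal ?_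
    rw [← mul_assoc ((1 + (n : ℝ)) ^ β), ← mul_assoc]
    refine le_mul_of_one_le_left (by positivity) ?_
    have := mul_le_mul_of_nonneg_left (hab n).1 (inv_pos.2 ha).le
    rwa [inv_mul_cancel₀ ha.ne'] at this
  have hsum : Summable fun n => ‖c n‖ ^ 2 :=
    ENNReal.summable_toReal (hle.trans_lt ENNReal.ofReal_lt_top).ne |>.congr fun n =>
      ENNReal.toReal_ofReal (by positivity)
  have key := lintegral_rpow_mul_norm_sq_le_tsum hs
    (S.continuous_output C z).aestronglyMeasurable (S.norm_output_le C z) hsum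
  rw [ENNReal.ofReal_tsum_of_nonneg (fun _ => by positivity) hsum] at key
  simp only [apply_onDomain_negPowDomain]
  rw [add_sub_cancel_left] at key
  exact key.trans hle

end Admissible

section AdmissibleHilbert

variable {H Y : Type*} [NormedAddCommGroup H] [InnerProductSpace ℂ H] [CompleteSpace H]
  [NormedAddCommGroup Y] [InnerProductSpace ℂ Y] [CompleteSpace Y] (S : ContractionSemigroup H)

theorem discrete_of_isAdmissible {β : ℝ} (hβ : 0 < β) (C : S.Domain →L[ℂ] Y)
    (h : S.IsAdmissible β C) :
    DiscreteObservation.IsAdmissible β (S.discreteObservation hβ.le C) S.cogenerator := by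
  obtain ⟨M, hM, h⟩ := h
  obtain ⟨a, b, ha, hb, hab⟩ := exists_rpow_mul_laguerreNormSq_bounds hβ
  have hs : 0 < 1 + β := by linarith
  refine ⟨b * M, by positivity, fun x => ?_⟩
  refine ENNReal.tsum_le_of_sum_range_le fun N => ?_
  rw [← ENNReal.ofReal_sum_of_nonneg fun _ _ => by positivity]
  refine ENNReal.ofReal_le_ofReal ?_
  -- Both sides are continuous in `x`, so it is enough to treat `x` in the domain.
  refine S.denseRange_negPow_one.induction_on (p := fun x =>
    ∑ n ∈ Finset.range N, (1 + (n : ℝ)) ^ β *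
      ‖S.discreteObservation hβ.le C ((S.cogenerator ^ n) x)‖ ^ 2 ≤ b * M * ‖x‖ ^ 2) x
    (isClosed_le (by fun_prop) (by fun_prop)) fun z => ?_
  rw [← ENNReal.ofReal_le_ofReal_iff (by positivity),
    ENNReal.ofReal_sum_of_nonneg fun _ _ => by positivity]
  refine (ENNReal.sum_le_tsum _).trans ?_
  have hz := h (S.negPowDomain one_re_pos le_rfl z)
  simp only [apply_onDomain_negPowDomain] at hz
  have key := tsum_le_lintegral_rpow_mul_norm_sq hs
    (S.continuous_output C z).aestronglyMeasurable
    (by rw [add_sub_cancel_left]; exact (hz.trans_lt ENNReal.ofReal_lt_top).ne)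
  have hz' := key.trans ((by rw [add_sub_cancel_left] : _ = _).trans_le hz)
  rw [mul_assoc, ENNReal.ofReal_mul hb.le]
  refine le_trans ?_ (mul_le_mul_right hz' _)
  rw [← ENNReal.tsum_mul_left]
  refine ENNReal.tsum_le_tsum fun n => ?_
  rw [← ENNReal.ofReal_mul hb.le, norm_sq_discreteObservation_cogenerator_pow]
  refine ENNReal.ofReal_le_ofReal ?_
  rw [← mul_assoc]
  exact mul_le_mul_of_nonneg_right (hab n).2 (by positivity)

end AdmissibleHilbert

end ContractionSemigroup

/-! ### Fractional powers under the Cayley transform -/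

theorem choose_neg_eq_ascPochhammer (a : ℂ) (n : ℕ) :
    Ring.choose (-a) n = (-1) ^ n * ((n.factorial : ℂ)⁻¹ * (ascPochhammer ℂ n).eval a) := by
  have h := Ring.factorial_nsmul_multichoose_eq_ascPochhammer a n
  rw [Polynomial.ascPochhammer_smeval_eq_eval, nsmul_eq_mul] at h
  have hn : (n.factorial : ℂ) ≠ 0 := by exact_mod_cast n.factorial_ne_zero
  rw [Ring.choose_neg', ← h, inv_mul_cancel_left₀ hn]
  simp [Units.smul_def, Int.coe_negOnePow_natCast]

namespace ContractionSemigroup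

section Cayley

variable {X : Type*} [NormedAddCommGroup X] [NormedSpace ℂ X] (S : ContractionSemigroup X)

/-- The integral defining `(l - A) ^ (-s) x`, as a function on all of `ℂ`; it is meaningful for
`0 < l.re`. -/
noncomputable def fracPow (s : ℝ) (x : X) (l : ℂ) : X :=
  (Real.Gamma s)⁻¹ • ∫ t in Ioi (0 : ℝ), S.powIntegrand l s x t

theorem fracPow_eq_negPow {l : ℂ} (hl : 0 < l.re) {s : ℝ} (hs : 0 < s) (x : X) :
    S.fracPow s x l = S.negPow hl hs x := rfl

theorem fracPow_eq_laplaceMoment (s : ℝ) (x : X) (l : ℂ) :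
    S.fracPow s x l = (Real.Gamma s)⁻¹ •
      laplaceMoment (fun t => t ^ (s - 1) • S t.toNNReal x) 0 (-l) := by
  rw [fracPow, laplaceMoment]
  congr 1
  refine integral_congr_ae (Eventually.of_forall fun t => ?_)
  simp only [powIntegrand, pow_zero, one_mul]
  rw [← Complex.coe_smul, smul_smul, mul_comm]

theorem hasDerivAt_fracPow {s : ℝ} (hs : 0 < s) (x : X) {l : ℂ} (hl : 0 < l.re) :
    HasDerivAt (S.fracPow s x) (-((s : ℂ) • S.fracPow (s + 1) x l)) l := by
  set u : ℝ → X := fun t => t ^ (s - 1) • S t.toNNReal x with hu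
  have hm : AEStronglyMeasurable u (volume.restrict (Ioi 0)) :=
    (aestronglyMeasurable_rpow _).smul (S.continuous_orbit x).aestronglyMeasurable
  have hi : ∀ r < (0 : ℝ), IntegrableOn (fun t => Real.exp (r * t) • u t) (Ioi 0) := by
    intro r hr
    refine (S.integrableOn_powIntegrand (l := ((-r : ℝ) : ℂ)) (by simpa using hr) hs x).congr
      (Eventually.of_forall fun t => ?_)
    simp only [powIntegrand, hu, smul_smul]
    rw [← Complex.coe_smul]
    push_cast
    rw [neg_neg, mul_comm]
  have h := ((hasDerivAt_laplaceMoment hm hi 0 (z := -l) (by simpa using hl)).scomp l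
    (hasDerivAt_neg l)).const_smul ((Real.Gamma s)⁻¹)
  convert! h using 1
  · funext w
    rw [fracPow_eq_laplaceMoment]; rfl
  · rw [fracPow, laplaceMoment, Real.Gamma_add_one hs.ne', neg_one_smul, smul_neg]
    have hG := (Real.Gamma_pos_of_pos hs).ne'
    have e : ∫ t in Ioi (0 : ℝ), S.powIntegrand l (s + 1) x t =
        ∫ t in Ioi (0 : ℝ), ((t : ℂ) ^ (0 + 1) * Complex.exp (-l * t)) • u t := by
      refine setIntegral_congr_fun measurableSet_Ioi fun t ht => ?_
      have ht' : (0 : ℝ) < t := ht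
      simp only [powIntegrand, hu]
      rw [← Complex.coe_smul, smul_smul, show s + 1 - 1 = s - 1 + 1 by ring,
        Real.rpow_add_one ht'.ne']
      push_cast
      congr 1
      ring
    rw [e, Complex.coe_smul, smul_smul, mul_inv, mul_inv_cancel_left₀ hs.ne']

/-- `(1 + w) ^ (-s) (l - A) ^ (-s) x` with `l = (1 - w) / (1 + w)`: this is the value at `w` of
`(I - w T) ^ (-s) (I - A) ^ (-s) x`. -/
noncomputable def cayleyPow (s : ℝ) (x : X) (w : ℂ) : X :=
  (1 + w) ^ (-(s : ℂ)) • S.fracPow s x ((1 - w) / (1 + w))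

theorem one_add_mem_slitPlane {w : ℂ} (hw : ‖w‖ < 1) : 1 + w ∈ Complex.slitPlane := by
  refine Or.inl ?_
  have := Complex.abs_re_le_norm w
  rw [Complex.add_re, Complex.one_re]
  linarith [neg_abs_le w.re]

theorem cayley_re {w : ℂ} (hw : ‖w‖ < 1) :
    ((1 - w) / (1 + w)).re = (1 - ‖w‖ ^ 2) / ‖1 + w‖ ^ 2 := by
  have h0 := Complex.slitPlane_ne_zero (one_add_mem_slitPlane hw)
  have h : Complex.normSq (1 + w) ≠ 0 := by simpa using h0
  rw [Complex.div_re, ← Complex.normSq_eq_norm_sq, ← Complex.normSq_eq_norm_sq]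
  field_simp
  simp [Complex.normSq_apply]
  ring

theorem cayley_re_pos {w : ℂ} (hw : ‖w‖ < 1) : 0 < ((1 - w) / (1 + w)).re := by
  have h0 := norm_pos_iff.2 (Complex.slitPlane_ne_zero (one_add_mem_slitPlane hw))
  rw [cayley_re hw]
  have : ‖w‖ ^ 2 < 1 := by nlinarith [norm_nonneg w]
  exact div_pos (by linarith) (by positivity)

theorem hasDerivAt_cayleyPow {s : ℝ} (hs : 0 < s) (x : X) {w : ℂ} (hw : ‖w‖ < 1) :
    HasDerivAt (S.cayleyPow s x) ((s * (1 + w) ^ (-(s : ℂ))) •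
      (-(1 + w)⁻¹ • S.fracPow s x ((1 - w) / (1 + w)) +
        (2 * (1 + w)⁻¹ ^ 2) • S.fracPow (s + 1) x ((1 - w) / (1 + w)))) w := by
  have hsl := one_add_mem_slitPlane hw
  have h0 := Complex.slitPlane_ne_zero hsl
  have h1 : HasDerivAt (fun w : ℂ => 1 + w) 1 w := (hasDerivAt_id w).const_add 1
  have h2 : HasDerivAt (fun w : ℂ => 1 - w) (-1) w := (hasDerivAt_id w).const_sub 1
  have h3 := h1.cpow_const (c := -(s : ℂ)) hsl
  have h4 := (S.hasDerivAt_fracPow hs x (cayley_re_pos hw)).scomp w (h2.div h1 h0)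
  convert! h3.smul h4 using 1
  rw [Complex.cpow_sub _ _ h0, Complex.cpow_one]
  simp only [Function.comp_apply]
  generalize (1 + w) ^ (-(s : ℂ)) = a
  match_scalars
  all_goals field_simp
  all_goals ring

theorem differentiableOn_cayleyPow {s : ℝ} (hs : 0 < s) (x : X) :
    DifferentiableOn ℂ (S.cayleyPow s x) (Metric.ball 0 1) := fun _ hw =>
  (S.hasDerivAt_cayleyPow hs x (by simpa using hw)).differentiableAt.differentiableWithinAt

variable [CompleteSpace X]

/-- The differential equation `(I - w T) U'(w) = s T U(w)` satisfied by `U(w) = (I - w T) ^ (-s)`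
holds for `cayleyPow`. -/
theorem cayleyPow_ode {s : ℝ} (hs : 0 < s) (x : X) {w : ℂ} (hw : ‖w‖ < 1) :
    deriv (S.cayleyPow s x) w - w • S.cogenerator (deriv (S.cayleyPow s x) w) =
      (s : ℂ) • S.cogenerator (S.cayleyPow s x w) := by
  have h0 := Complex.slitPlane_ne_zero (one_add_mem_slitPlane hw)
  have hl := cayley_re_pos hw
  rw [(S.hasDerivAt_cayleyPow hs x hw).deriv, cayleyPow]
  set l := (1 - w) / (1 + w) with hl'
  have hP := S.negPow_add_one hl hs (by positivity) x
  rw [← fracPow_eq_negPow, ← fracPow_eq_negPow] at hP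
  set P := S.fracPow s x l
  set p := S.fracPow (s + 1) x l
  -- `p = (l - A)⁻¹ P`, and the resolvent identity gives `(I - A)⁻¹ P`.
  set R := S.negPow one_re_pos one_pos with hR
  have hRP : R P = p - (1 - l) • R p := by
    have h1 := S.sub_gen_negPowDomain_one hl P
    set u := S.negPowDomain hl le_rfl P with hu
    have h2 : S.incl u = p := hP.symm
    have h3 := S.resolvent_left one_re_pos u
    rw [one_smul, ← hR, map_sub, h2] at h3
    rw [h2] at h1
    rw [← h1, map_sub, map_smul, sub_smul, one_smul]
    nth_rewrite 2 [← h3]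
    abel
  have hT : ∀ y, S.cogenerator y = (2 : ℂ) • R y - y := fun y => by
    rw [cogenerator_eq]; rfl
  have h1l : 1 - l = 2 * w * (1 + w)⁻¹ := by
    rw [hl']; field_simp; ring
  rw [h1l] at hRP
  simp only [hT, map_smul, map_add, hRP]
  generalize R p = q
  generalize (1 + w) ^ (-(s : ℂ)) = a
  match_scalars
  all_goals field_simp
  all_goals ring

/-- The `n`-th derivative of the differential equation for `cayleyPow`. -/
theorem iteratedDeriv_cayleyPow_ode {s : ℝ} (hs : 0 < s) (x : X) (n : ℕ) {w : ℂ}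
    (hw : w ∈ Metric.ball (0 : ℂ) 1) :
    iteratedDeriv (n + 1) (S.cayleyPow s x) w -
        w • S.cogenerator (iteratedDeriv (n + 1) (S.cayleyPow s x) w) =
      ((s : ℂ) + n) • S.cogenerator (iteratedDeriv n (S.cayleyPow s x) w) := by
  induction n generalizing w with
  | zero => simpa using S.cayleyPow_ode hs x (by simpa using hw)
  | succ n ih =>
    -- Differentiating the identity for `n` moves one term `T U⁽ⁿ⁺¹⁾` to the right hand side.
    have hd : ∀ k, HasDerivAt (iteratedDeriv k (S.cayleyPow s x))
        (iteratedDeriv (k + 1) (S.cayleyPow s x) w) w := fun k => by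
      rw [iteratedDeriv_succ]
      have ha := (S.differentiableOn_cayleyPow hs x).analyticOnNhd Metric.isOpen_ball
      have hk := (ha.iterated_deriv k) w hw
      rw [← iteratedDeriv_eq_iterate] at hk
      exact hk.differentiableAt.hasDerivAt
    have hL := (hd (n + 1)).sub ((hasDerivAt_id w).smul
      (S.cogenerator.hasFDerivAt.comp_hasDerivAt w (hd (n + 1))))
    have hR := (S.cogenerator.hasFDerivAt.comp_hasDerivAt w (hd n)).const_smul ((s : ℂ) + n)
    have heq := hL.unique (hR.congr_of_eventuallyEq (by
      filter_upwards [Metric.isOpen_ball.mem_nhds hw] with v hv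
      exact ih hv))
    simp only [id, one_smul, Function.comp_apply] at heq
    rw [Nat.cast_succ, ← add_assoc, add_smul _ (1 : ℂ), one_smul, ← heq]
    abel

theorem iteratedDeriv_cayleyPow_zero {s : ℝ} (hs : 0 < s) (x : X) (n : ℕ) :
    iteratedDeriv n (S.cayleyPow s x) 0 =
      (ascPochhammer ℂ n).eval (s : ℂ) • (S.cogenerator ^ n) (S.negPow one_re_pos hs x) := by
  induction n with
  | zero =>
    simp [cayleyPow, ← fracPow_eq_negPow]
  | succ n ih =>
    have h := S.iteratedDeriv_cayleyPow_ode hs x n (w := 0) (by simp)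
    rw [zero_smul, sub_zero] at h
    rw [h, ih, map_smul, smul_smul, pow_succ', mul_apply_eq_comp, ascPochhammer_succ_eval, mul_comm]

theorem hasSum_cayleyPow {s : ℝ} (hs : 0 < s) (x : X) {w : ℂ} (hw : ‖w‖ < 1) :
    HasSum (fun n : ℕ => Ring.choose (-(s : ℂ)) n •
      ((-(w • S.cogenerator)) ^ n) (S.negPow one_re_pos hs x)) (S.cayleyPow s x w) := by
  convert Complex.hasSum_taylorSeries_on_ball (S.differentiableOn_cayleyPow hs x)
    (show w ∈ Metric.ball (0 : ℂ) 1 by simpa using hw) using 2 with n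
  rw [S.iteratedDeriv_cayleyPow_zero hs, choose_neg_eq_ascPochhammer, sub_zero, ← neg_smul,
    smul_pow, smul_apply, smul_smul, smul_smul, smul_smul, neg_pow w]
  congr 1
  have : ((-1 : ℂ) ^ n) * (-1) ^ n = 1 := by rw [← mul_pow]; simp
  linear_combination ((n.factorial : ℂ)⁻¹ * (ascPochhammer ℂ n).eval (s : ℂ) * w ^ n) * this

/-- The operator binomial series converges absolutely where the scalar one does. The constant term
is estimated separately, as the identity operator has norm zero on the zero space. -/
theorem summable_choose_smul_pow (B : X →L[ℂ] X) (hB : ‖B‖ < 1) (a : ℂ) :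
    Summable fun n : ℕ => Ring.choose a n • B ^ n := by
  have h1 : (‖B‖₊ : ℝ≥0∞) < (binomialSeries ℂ a).radius :=
    lt_of_lt_of_le (by exact_mod_cast hB) binomialSeries_radius_ge_one
  have h2 := (binomialSeries ℂ a).summable_norm_mul_pow h1
  refine Summable.of_norm (Summable.of_nonneg_of_le (fun _ => norm_nonneg _) (fun n => ?_) h2)
  rw [norm_smul, binomialSeries, FormalMultilinearSeries.ofScalars_norm, coe_nnnorm]
  gcongr
  rcases n.eq_zero_or_pos with rfl | hn
  · rw [pow_zero, pow_zero]
    exact ContinuousLinearMap.norm_id_le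
  · exact norm_pow_le' B hn

theorem hasSum_oneAddPow_apply (B : X →L[ℂ] X) (hB : ‖B‖ < 1) (a : ℂ) (x : X) :
    HasSum (fun n : ℕ => Ring.choose a n • (B ^ n) x) (DiscreteObservation.oneAddPow B a x) := by
  have h := (summable_choose_smul_pow B hB a).hasSum
  have h2 : DiscreteObservation.oneAddPow B a = ∑' n, Ring.choose a n • B ^ n :=
    FormalMultilinearSeries.ofScalars_sum_eq _ _
  rw [← h2] at h
  exact h.mapL (ContinuousLinearMap.apply ℂ X x)

/-- `(I - w T) ^ (-s) (I - A) ^ (-s) = (1 + w) ^ (-s) (l - A) ^ (-s)` with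
`l = (1 - w) / (1 + w)`. -/
theorem oneAddPow_cogenerator_negPow (hT : ‖S.cogenerator‖ ≤ 1) {s : ℝ} (hs : 0 < s) (x : X)
    {w : ℂ} (hw : ‖w‖ < 1) :
    DiscreteObservation.oneAddPow (-(w • S.cogenerator)) (-(s : ℂ)) (S.negPow one_re_pos hs x) =
      (1 + w) ^ (-(s : ℂ)) • S.negPow (cayley_re_pos hw) hs x := by
  have hB : ‖-(w • S.cogenerator)‖ < 1 := by
    rw [norm_neg, norm_smul]
    nlinarith [norm_nonneg w, norm_nonneg S.cogenerator]
  exact (hasSum_oneAddPow_apply _ hB _ _).unique (S.hasSum_cayleyPow hs x hw)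

theorem oneAddPow_apply_semigroup (hT : ‖S.cogenerator‖ ≤ 1) {w : ℂ} (hw : ‖w‖ < 1) (a : ℂ)
    (t : ℝ≥0) (x : X) :
    DiscreteObservation.oneAddPow (-(w • S.cogenerator)) a (S t x) =
      S t (DiscreteObservation.oneAddPow (-(w • S.cogenerator)) a x) := by
  have hB : ‖-(w • S.cogenerator)‖ < 1 := by
    rw [norm_neg, norm_smul]
    nlinarith [norm_nonneg w, norm_nonneg S.cogenerator]
  refine (hasSum_oneAddPow_apply _ hB _ _).unique ?_
  convert (hasSum_oneAddPow_apply _ hB a x).mapL (S t) using 2 with n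
  rw [← neg_smul, smul_pow]
  simp only [map_smul, smul_apply, cogenerator_pow_apply_semigroup]

theorem discreteObservation_comp_oneAddPow {Y : Type*} [NormedAddCommGroup Y] [NormedSpace ℂ Y]
    (hT : ‖S.cogenerator‖ ≤ 1) {β : ℝ} (hβ : 0 ≤ β) (C : S.Domain →L[ℂ] Y) {w : ℂ}
    (hw : ‖w‖ < 1) :
    (S.discreteObservation hβ C).comp
        (DiscreteObservation.oneAddPow (-(w • S.cogenerator)) (-(β : ℂ) - 1)) =
      (1 + w) ^ (-((1 + β : ℝ) : ℂ)) •
        C.comp (S.negPowDomain (cayley_re_pos hw) (le_add_of_nonneg_right hβ : 1 ≤ 1 + β)) := by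
  have ha : -(β : ℂ) - 1 = -((1 + β : ℝ) : ℂ) := by push_cast; ring
  have hs : 0 < 1 + β := by linarith
  ext x
  rw [discreteObservation, ha]
  simp only [ContinuousLinearMap.comp_apply, smul_apply]
  rw [← map_smul]
  congr 1
  refine S.negPowDomain_eq_of_incl _ _ ?_
  rw [map_smul, incl_negPowDomain, ← S.oneAddPow_cogenerator_negPow hT hs x hw]
  exact S.negPow_comm one_re_pos hs _
    (fun t z => S.oneAddPow_apply_semigroup hT hw _ t z) x

/-- The expressions bounded by the two resolvent conditions agree at points which correspond under
the Cayley transform. -/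
theorem resolvent_terms_eq {Y : Type*} [NormedAddCommGroup Y] [NormedSpace ℂ Y]
    (hT : ‖S.cogenerator‖ ≤ 1) {β : ℝ} (hβ : 0 ≤ β) (C : S.Domain →L[ℂ] Y) {w : ℂ}
    (hw : ‖w‖ < 1) :
    (1 - ‖w‖ ^ 2) ^ ((1 + β) / 2) * ‖(S.discreteObservation hβ C).comp
        (DiscreteObservation.oneAddPow (-(w • S.cogenerator)) (-(β : ℂ) - 1))‖ =
      ((1 - w) / (1 + w)).re ^ ((1 + β) / 2) *
        ‖C.comp (S.negPowDomain (cayley_re_pos hw) (le_add_of_nonneg_right hβ : 1 ≤ 1 + β))‖ := by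
  have h0 := norm_pos_iff.2 (Complex.slitPlane_ne_zero (one_add_mem_slitPlane hw))
  have h1 : 0 ≤ 1 - ‖w‖ ^ 2 := by nlinarith [norm_nonneg w]
  rw [S.discreteObservation_comp_oneAddPow hT hβ C hw, norm_smul, ← Complex.ofReal_neg,
    Complex.norm_cpow_real, cayley_re hw, Real.div_rpow h1 (by positivity), ← mul_assoc,
    Real.rpow_neg h0.le, ← Real.rpow_natCast ‖1 + w‖ 2, ← Real.rpow_mul h0.le, div_eq_mul_inv]
  congr 4
  push_cast
  ring

theorem exists_cayley_eq {l : ℂ} (hl : 0 < l.re) : ∃ w : ℂ, ‖w‖ < 1 ∧ (1 - w) / (1 + w) = l := by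
  have h0 : 1 + l ≠ 0 := fun h => by
    have := congrArg Complex.re h
    simp at this
    linarith
  refine ⟨(1 - l) / (1 + l), ?_, ?_⟩
  · rw [norm_div, div_lt_one (norm_pos_iff.2 h0), ← sq_lt_sq₀ (norm_nonneg _) (norm_nonneg _),
      ← Complex.normSq_eq_norm_sq, ← Complex.normSq_eq_norm_sq]
    simp only [Complex.normSq_apply, Complex.sub_re, Complex.sub_im, Complex.add_re,
      Complex.add_im, Complex.one_re, Complex.one_im]
    nlinarith
  · have h2 : 1 + (1 - l) / (1 + l) = 2 / (1 + l) := by field_simp; ring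
    rw [h2]
    field_simp
    ring

theorem discrete_resolventCondition_iff {Y : Type*} [NormedAddCommGroup Y] [NormedSpace ℂ Y]
    (hT : ‖S.cogenerator‖ ≤ 1) {β : ℝ} (hβ : 0 ≤ β) (C : S.Domain →L[ℂ] Y) :
    DiscreteObservation.ResolventCondition β (S.discreteObservation hβ C) S.cogenerator ↔
      S.ResolventCondition hβ C := by
  refine iff_of_eq (congrArg BddAbove (Set.ext fun r => ⟨?_, ?_⟩))
  · rintro ⟨z, hz, rfl⟩
    have hw : ‖starRingEnd ℂ z‖ < 1 := by rwa [RCLike.norm_conj]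
    have h := S.resolvent_terms_eq hT hβ C hw
    rw [RCLike.norm_conj] at h
    exact ⟨_, cayley_re_pos hw, h⟩
  · rintro ⟨l, hl, rfl⟩
    obtain ⟨w, hw, rfl⟩ := exists_cayley_eq hl
    refine ⟨starRingEnd ℂ w, by rwa [RCLike.norm_conj], ?_⟩
    rw [RCLike.norm_conj, starRingEnd_self_apply]
    exact (S.resolvent_terms_eq hT hβ C hw).symm

end Cayley

end ContractionSemigroup

theorem mainTheorem6 {H Y : Type*}
    [NormedAddCommGroup H] [InnerProductSpace ℂ H] [CompleteSpace H]
    [NormedAddCommGroup Y] [InnerProductSpace ℂ Y] [CompleteSpace Y]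
    (β : ℝ) (hβ : 0 < β) (S : ContractionSemigroup H) (C : S.Domain →L[ℂ] Y) :
    (S.IsAdmissible β C ↔
      DiscreteObservation.IsAdmissible β (S.discreteObservation hβ.le C) S.cogenerator) ∧
    (DiscreteObservation.ResolventCondition β (S.discreteObservation hβ.le C) S.cogenerator ↔
      S.ResolventCondition hβ.le C) := by
  exact ⟨⟨S.discrete_of_isAdmissible hβ C, S.isAdmissible_of_discrete hβ C⟩,
    S.discrete_resolventCondition_iff S.norm_cogenerator_le_one hβ.le C⟩
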